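/- **Setting.** A sample space is a nonempty finite set (with counting measure), the real line (with Lebesgue measure), or a finite product of such spaces (with the product measure); $\mu$ denotes the reference measure and distributions are identified with their densities. Let $\Omega_{\mathrm{in}}$ be a finite sample space and $\Omega_{\mathrm{out}}$ any sample space. A channel $\Phi$ from $\Omega_{\mathrm{in}}$ to $\Omega_{\mathrm{out}}$ is a family of probability densities $\Phi(\cdot|x)$, $x\in\Omega_{\mathrm{in}}$, on $\Omega_{\mathrm{out}}$. For a probability density $p$ and an integrable $\delta$ put $J_p(\delta)=\int \delta^2/p\,d\mu\in[0,\infty]$ (with $0/0=0$, $a/0=\infty$ for $a>0$). A tangent vector at $\Phi$ is a $\Delta=c(\Psi_1-\Psi_2)$ with $c\in\mathbb R$ and channels $\Psi_1,\Psi_2$ such that $J_{\Phi(\cdot|x)}(\Delta(\cdot|x))<\infty$ for all $x$. Write $$G^{\min}_\Phi(\Delta)=\max_{x\in\Omega_{\mathrm{in}}}J_{\Phi(\cdot|x)}\bigl(\Delta(\cdot|x)\bigr),\qquad \Delta^{(n)}=\sum_{i=1}^n\Phi^{\otimes(i-1)}\otimes\Delta\otimes\Phi^{\otimes(n-i)},$$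 and $\|\Lambda\|_{\mathrm{cb}}=\sup_p\|(\Lambda\otimes\mathbf I)(p)\|_1$, the supremum being over all probability densities $p$ on products of the input space with an ancillary sample space. A channel metric $G$ assigns to every channel $\Phi$ (from any finite sample space to any sample space) and every tangent vector $\Delta$ at $\Phi$ a real number $G_\Phi(\Delta)$ such that, for each $\Phi$, $\Delta\mapsto G_\Phi(\Delta)$ is the square of a norm (functions that agree almost everywhere being identified). Consider the following axioms, for all channels $\Phi$ and tangent vectors $\Delta$ at $\Phi$. * (M1) $G_\Phi(\Delta)\ge G_{\Phi\circ\Psi}(\Delta\circ\Psi)$ for every channel $\Psi$ from a finite sample space to the input space of $\Phi$. * (M2) $G_\Phi(\Delta)\ge G_{\Psi\circ\Phi}(\Psi\circ\Delta)$ for every Markov map $\Psi$ from the output space of $\Phi$ to a sample space that sends densities to densities. * (E) $G_{\Phi\otimes\mathbf I}(\Delta\otimes\mathbf I)=G_\Phi(\Delta)$, where $\mathbf I$ is the identity channel of any finite sample space. * (A) $\lim_{n\to\infty}\frac1n G_{\Phi^{\otimes n}}(\Delta^{(n)})=G_\Phi(\Delta)$. * (C) If $\Phi^n$ are channels with the input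 and output spaces of $\Phi^{\otimes n}$ and $\Delta^n$ are tangent vectors at $\Phi^n$ with $\|\Phi^n-\Phi^{\otimes n}\|_{\mathrm{cb}}\to0$ and $\frac1{\sqrt n}\|\Delta^n-\Delta^{(n)}\|_{\mathrm{cb}}\to0$, then $$\liminf_{n\to\infty}\frac1n\bigl(G_{\Phi^n}(\Delta^n)-G_{\Phi^{\otimes n}}(\Delta^{(n)})\bigr)\ge0 .$$ * (N0) If $\Phi(\cdot|x)$ is the density $\varphi$ of $\mathrm N(0,1)$ and $\Delta(y|x)=y\,\varphi(y)$ for all $x$, then $G_\Phi(\Delta)=1$. **Theorem.** Let $\Omega_{\mathrm{in}}$ be finite, let $\Phi$ be a channel from $\Omega_{\mathrm{in}}$ to $\Omega_{\mathrm{out}}$ and $\Delta$ a tangent vector at $\Phi$. Suppose that for every $x\in\Omega_{\mathrm{in}}$ the pair $p=\Phi(\cdot|x)$, $\delta=\Delta(\cdot|x)$, with $L=\delta/p$ regarded as a random variable under $p$, satisfies $\mathbb E_p L^4<\infty$ and at least one of the following: * (a) $\Omega_{\mathrm{out}}$ is finite; * (b) $L$ has a density $\mathrm p_L$ with respect to Lebesgue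 measure and, with $J=J_p(\delta)$, $$\mathbb E\left(\frac{\int_{-\infty}^{L}(-t)\,\mathrm p_L(t)\,dt}{J\,\mathrm p_L(L)}\right)^{2}<\infty .$$ Then every channel metric $G$ that satisfies (M1), (M2), (E), (A), (C) and (N0) satisfies $G_\Phi(\Delta)=G^{\min}_\Phi(\Delta)$. Moreover, $G^{\min}$ itself satisfies (C). -/

import Mathlib

open MeasureTheory ProbabilityTheory Filter Topology
open scoped ENNReal

noncomputable section

/-- The sample spaces: the finite sets with at least one point, the real line, and everything
obtained from these by finite products (in particular `ℝ ^ d` is `power real d`). -/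
inductive Space : Type
  | finite (k : ℕ) : Space
  | real : Space
  | prod (A B : Space) : Space
  | power (A : Space) (n : ℕ) : Space

namespace Space

/-- The set underlying a sample space; `finite k` has the `k + 1` points `0, …, k`. -/
def Carrier : Space → Type
  | finite k => Fin (k + 1)
  | real => ℝ
  | prod A B => Carrier A × Carrier B
  | power A n => Fin n → Carrier A

instance : CoeSort Space Type := ⟨Carrier⟩

/-- The reference measure `μ`: counting measure on finite sets, Lebesgue measure on `ℝ`, and product
measures on products. -/
instance instMeasureSpace : (A : Space) → MeasureSpace A.Carrier
  | finite k => @MeasureSpace.mk (Fin (k + 1)) ⊤ (@Measure.count (Fin (k + 1)) ⊤)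
  | real => inferInstanceAs (MeasureSpace ℝ)
  | prod A B => @Measure.prod.measureSpace A.Carrier B.Carrier (instMeasureSpace A) (instMeasureSpace B)
  | power A n => @MeasureSpace.pi (Fin n) _ (fun _ => A.Carrier) fun _ => instMeasureSpace A

end Space

/-! ### Local data of probability distributions -/

/-- `p` is a probability density with respect to the reference measure. -/
structure IsDensity {B : Space} (p : B → ℝ) : Prop where
  measurable : Measurable p
  nonneg : ∀ y, 0 ≤ p y
  lintegral_eq_one : ∫⁻ y, ENNReal.ofReal (p y) = 1

/-- The probability distribution with density `p`. -/
def law {B : Space} (p : B → ℝ) : Measure B :=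
  volume.withDensity fun y => ENNReal.ofReal (p y)

/-- The Fisher information `J_p(δ) = ∫ δ² / p dμ`, with `0 / 0 = 0` and `a / 0 = ∞` for `a > 0`; so
it is infinite unless `δ` is absolutely continuous with respect to `p`. -/
def fisher {B : Space} (p δ : B → ℝ) : ℝ≥0∞ :=
  ∫⁻ y, ENNReal.ofReal (δ y ^ 2) / ENNReal.ofReal (p y)

/-- The logarithmic derivative `L = δ / p`. -/
def score {B : Space} (p δ : B → ℝ) : B → ℝ := fun y => δ y / p y

/-- The law of `L = δ / p` under `p` has a density `p_L` with respect to Lebesgue measure, and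
`𝔼 (∫_{-∞}^L (-t) p_L(t) dt / (J p_L(L)))² < ∞`. -/
def HasRegularScoreDensity {B : Space} (p δ : B → ℝ) : Prop :=
  ∃ pL : ℝ → ℝ, Measurable pL ∧ (∀ l, 0 ≤ pL l) ∧
    (law p).map (score p δ) = volume.withDensity (fun l => ENNReal.ofReal (pL l)) ∧
    ∫⁻ l, ENNReal.ofReal
        (((∫ t in Set.Iic l, (-t) * pL t) / ((fisher p δ).toReal * pL l)) ^ 2)
      * ENNReal.ofReal (pL l) < ∞

/-- The regularity conditions on `{p, δ}` in the uniqueness theorem: either the sample space is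
finite or the score has a regular density; and `𝔼_p L⁴ < ∞`. -/
def IsRegularLocalData {B : Space} (p δ : B → ℝ) : Prop :=
  (Finite B ∨ HasRegularScoreDensity p δ) ∧ Integrable (fun y => score p δ y ^ 4) (law p)

/-! ### Channels with finite input sets -/

/-- A channel, given by the output densities `Φ(· | x)`. -/
def IsChannel {A B : Space} (Φ : A → B → ℝ) : Prop := ∀ x, IsDensity (Φ x)

/-- `Δ` is a tangent vector at the channel `Φ`: it has the form `c (Ψ₁ - Ψ₂)` with channels
`Ψ₁, Ψ₂`, and its Fisher information is finite for every input. -/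
def IsTangent {A B : Space} (Φ Δ : A → B → ℝ) : Prop :=
  (∃ (c : ℝ) (Ψ₁ Ψ₂ : A → B → ℝ), IsChannel Ψ₁ ∧ IsChannel Ψ₂ ∧
    ∀ x y, Δ x y = c * (Ψ₁ x y - Ψ₂ x y)) ∧
  ∀ x, fisher (Φ x) (Δ x) < ∞

/-- The composition `Λ ∘ Ψ`, where `Ψ` is a channel between finite sets (whose reference measure is
the counting measure, so that the integral is a sum) and `Λ` is a channel or a tangent vector. -/
def precomp {A' A B : Space} (Λ : A → B → ℝ) (Ψ : A' → A → ℝ) : A' → B → ℝ :=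
  fun w y => ∫ x : A, Λ x y * Ψ w x

/-- `κ` is a Markov map: a Markov kernel that sends densities to densities. -/
structure IsMarkovMap {B B' : Space} (κ : Kernel B B') : Prop where
  isMarkovKernel : IsMarkovKernel κ
  absolutelyContinuous : (volume : Measure B).bind κ ≪ (volume : Measure B')

/-- The function `g` is (a version of) the image `κ(f)` of the integrable function `f`. -/
def IsImage {B B' : Space} (κ : Kernel B B') (f : B → ℝ) (g : B' → ℝ) : Prop :=
  ∀ S : Set B', MeasurableSet S → ∫ z in S, g z = ∫ y, (κ y).real S * f y

open Classical in
/-- The tensor product `Λ ⊗ 𝐈` with the identity channel of the finite set `C`. -/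
def tensorId {A B : Space} (C : Space) (Λ : A → B → ℝ) : A.prod C → B.prod C → ℝ :=
  fun x y => Λ x.1 y.1 * if x.2 = y.2 then 1 else 0

/-- The tensor power `Φ^{⊗ n}`. -/
def tensorPow {A B : Space} (Φ : A → B → ℝ) (n : ℕ) : A.power n → B.power n → ℝ :=
  fun x y => ∏ i : Fin n, Φ (x i) (y i)

/-- `Δ^{(n)} = Δ ⊗ Φ^{⊗ (n-1)} + Φ ⊗ Δ ⊗ Φ^{⊗ (n-2)} + ⋯ + Φ^{⊗ (n-1)} ⊗ Δ`. -/
def tangentPow {A B : Space} (Φ Δ : A → B → ℝ) (n : ℕ) : A.power n → B.power n → ℝ :=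
  fun x y => ∑ i : Fin n, Δ (x i) (y i) * ∏ j ∈ Finset.univ.erase i, Φ (x j) (y j)

/-- The completely bounded norm `‖Λ‖_cb = sup_p ‖(Λ ⊗ 𝐈)(p)‖₁`, the supremum being over all
ancillary sample spaces `R` and all probability densities `p` on the product of the (finite) input
set with `R`. -/
def cbNorm {A B : Space} (Λ : A → B → ℝ) : ℝ≥0∞ :=
  ⨆ (R : Space) (p : A.prod R → ℝ) (_ : IsDensity p),
    ∫⁻ z : B.prod R, ‖∫ x : A, Λ x z.1 * p (x, z.2)‖ₑ

/-! ### Channel metrics and the axioms -/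

/-- A real number `G A B Φ Δ` for all input spaces `A`, output spaces `B`, and local data `{Φ, Δ}`.
Only the values at finite `A`, channels `Φ` and tangent vectors `Δ` at `Φ` are ever used. -/
abbrev ChannelFunctional : Type := (A B : Space) → (A → B → ℝ) → (A → B → ℝ) → ℝ

/-- `G` is the square of a norm on the tangent space at each channel with finite input set. -/
structure IsChannelMetric (G : ChannelFunctional) : Prop where
  nonneg : ∀ (A B : Space) [Finite A] (Φ Δ : A → B → ℝ), IsChannel Φ → IsTangent Φ Δ →
    0 ≤ G A B Φ Δ
  eq_zero_iff : ∀ (A B : Space) [Finite A] (Φ Δ : A → B → ℝ), IsChannel Φ → IsTangent Φ Δ →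
    (G A B Φ Δ = 0 ↔ ∀ x, Δ x =ᵐ[volume] 0)
  smul : ∀ (A B : Space) [Finite A] (Φ Δ : A → B → ℝ) (c : ℝ), IsChannel Φ → IsTangent Φ Δ →
    G A B Φ (c • Δ) = c ^ 2 * G A B Φ Δ
  triangle : ∀ (A B : Space) [Finite A] (Φ Δ Δ' : A → B → ℝ), IsChannel Φ → IsTangent Φ Δ →
    IsTangent Φ Δ' → √(G A B Φ (Δ + Δ')) ≤ √(G A B Φ Δ) + √(G A B Φ Δ')

/-- (M1): `G_Φ(Δ) ≥ G_{Φ ∘ Ψ}(Δ ∘ Ψ)`. -/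
def AxiomM1 (G : ChannelFunctional) : Prop :=
  ∀ (A' A B : Space) [Finite A'] [Finite A] (Φ Δ : A → B → ℝ) (Ψ : A' → A → ℝ),
    IsChannel Φ → IsTangent Φ Δ → IsChannel Ψ →
    G A' B (precomp Φ Ψ) (precomp Δ Ψ) ≤ G A B Φ Δ

/-- (M2): `G_Φ(Δ) ≥ G_{Ψ ∘ Φ}(Ψ ∘ Δ)`; here `κ` is `Ψ`, and `Φ'`, `Δ'` are `Ψ ∘ Φ`, `Ψ ∘ Δ`. -/
def AxiomM2 (G : ChannelFunctional) : Prop :=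
  ∀ (A B B' : Space) [Finite A] (Φ Δ : A → B → ℝ) (Φ' Δ' : A → B' → ℝ) (κ : Kernel B B'),
    IsChannel Φ → IsTangent Φ Δ → IsChannel Φ' → IsTangent Φ' Δ' → IsMarkovMap κ →
    (∀ x, IsImage κ (Φ x) (Φ' x)) → (∀ x, IsImage κ (Δ x) (Δ' x)) →
    G A B' Φ' Δ' ≤ G A B Φ Δ

/-- (E): `G_{Φ ⊗ 𝐈}(Δ ⊗ 𝐈) = G_Φ(Δ)`. -/
def AxiomE (G : ChannelFunctional) : Prop :=
  ∀ (A B C : Space) [Finite A] [Finite C] (Φ Δ : A → B → ℝ), IsChannel Φ → IsTangent Φ Δ →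
    G (A.prod C) (B.prod C) (tensorId C Φ) (tensorId C Δ) = G A B Φ Δ

/-- (A), weak asymptotic additivity: `G_{Φ^{⊗ n}}(Δ^{(n)}) / n → G_Φ(Δ)`. -/
def AxiomA (G : ChannelFunctional) : Prop :=
  ∀ (A B : Space) [Finite A] (Φ Δ : A → B → ℝ), IsChannel Φ → IsTangent Φ Δ →
    Tendsto (fun n : ℕ => (1 / (n : ℝ)) *
      G (A.power n) (B.power n) (tensorPow Φ n) (tangentPow Φ Δ n)) atTop (𝓝 (G A B Φ Δ))

/-- (C), weak asymptotic continuity: if `‖Φⁿ - Φ^{⊗ n}‖_cb → 0` and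
`n^{-1/2} ‖Δⁿ - Δ^{(n)}‖_cb → 0`, then `liminf (G_{Φⁿ}(Δⁿ) - G_{Φ^{⊗ n}}(Δ^{(n)})) / n ≥ 0`. The
lower limit is taken in the extended real line. -/
def AxiomC (G : ChannelFunctional) : Prop :=
  ∀ (A B : Space) [Finite A] (Φ Δ : A → B → ℝ), IsChannel Φ → IsTangent Φ Δ →
    ∀ Φs Δs : (n : ℕ) → A.power n → B.power n → ℝ,
      (∀ n, IsChannel (Φs n)) → (∀ n, IsTangent (Φs n) (Δs n)) →
      Tendsto (fun n => cbNorm (Φs n - tensorPow Φ n)) atTop (𝓝 0) →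
      Tendsto (fun n : ℕ => cbNorm (Δs n - tangentPow Φ Δ n) / ENNReal.ofReal √(n : ℝ))
        atTop (𝓝 0) →
      0 ≤ liminf (fun n : ℕ => (((1 / (n : ℝ)) *
        (G (A.power n) (B.power n) (Φs n) (Δs n) -
          G (A.power n) (B.power n) (tensorPow Φ n) (tangentPow Φ Δ n)) : ℝ) : EReal)) atTop

/-- (N0): the metric is `1` at the standard Gaussian shift `{N(0,1), δN(0,1)}`, a distribution being
identified with the channel that has it as output for every input. -/
def AxiomN0 (G : ChannelFunctional) : Prop :=
  ∀ (A : Space) [Finite A],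
    G A Space.real (fun _ (y : ℝ) => gaussianPDFReal 0 1 y)
      (fun _ (y : ℝ) => y * gaussianPDFReal 0 1 y) = 1

/-- `G^min_Φ(Δ)`, the maximum over the inputs `x` of the Fisher information of `Φ(· | x)` in the
direction `Δ(· | x)`. -/
def Gmin : ChannelFunctional :=
  fun _ _ Φ Δ => (⨆ x, fisher (Φ x) (Δ x)).toReal

end

/-! Asymptotically only the variance of the score matters. By the central limit theorem the score
sum of `n` copies of `{p, δ}`, divided by `√n`, is nearly `N(0, J)` with `J = J_p(δ)`. Two local
data whose normalized scores `S` and `T` have nearly the same law can be converted into each other: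
cut the line into finitely many cells, read off the cell of `S`, and draw the new point from `q`
conditioned on `T` lying in that cell. The image of `p` is close to `q` because the cell
probabilities nearly agree. The image of `√n p S` is close to `√n q T` because both scores are near
the centre of the common cell. If `T` has variance smaller than `J`, it is first completed by
independent Gaussian noise `σ W`; as `W` is centred, averaging over it returns `T`. Since there are
finitely many cells, convergence in law is all that is needed. `exists_simulation` is the resulting
statement, uniform in the input sequence. `le_of_asymptotic_approx` converts such approximations
into inequalities between metrics, by means of (A) and (C).

Lower bound (`fisher_le_metric`, `fisher_le_channelMetric`): copies of `{p, δ}` simulate copies of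
the Gaussian shift of speed `√J`, whose metric is `J` by (N0) and homogeneity. Hence (M2) gives `J ≤
G` at `{p, δ}`, and (M1) with a constant preparation of one input extends this to channels.

Upper bound (`metric_le_of_fisher_le`): let `J` bound the Fisher information at every input. A
single Gaussian shift of speed `√(n J)`, tensored with the identity on the input sequences, has
metric `n J` by (E). After a measurement of the cell, the transmitted input `w` tells the Markov map
which product distribution to simulate, so that `Φ^{⊗ n}` and `Δ^{(n)}` are approximated by a
channel and a tangent vector with metric at most `n J`.

Property (C) of the minimal metric (`axiomC_Gmin`): use the constant input sequence at a maximizing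
`x₀`, and bound the Fisher information from below by the Cauchy–Schwarz inequality with a truncation
of the normalized score as test function. A bounded test function is stable under small `L¹`
perturbations, and by the central limit theorem the bound tends to a truncated variance, arbitrarily
close to `J`. -/

noncomputable section

/-! ### Sample spaces -/

namespace Space

instance instNonemptyCarrier : (A : Space) → Nonempty A.Carrier
  | finite k => inferInstanceAs (Nonempty (Fin (k + 1)))
  | real => inferInstanceAs (Nonempty ℝ)
  | prod A B => @instNonemptyProd _ _ (instNonemptyCarrier A) (instNonemptyCarrier B)
  | power A _ => @Pi.instNonempty _ _ fun _ => instNonemptyCarrier A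

instance instSigmaFiniteVolume : (A : Space) → SigmaFinite (volume : Measure A.Carrier)
  | finite k => by
    -- The reference measure is defined with `⊤` given explicitly, so this structure is installed by
    -- hand.
    let _ : MeasurableSpace (Fin (k + 1)) := ⊤
    have : MeasurableSingletonClass (Fin (k + 1)) := ⟨fun _ => trivial⟩
    exact inferInstanceAs (SigmaFinite (Measure.count : Measure (Fin (k + 1))))
  | real => inferInstanceAs (SigmaFinite (volume : Measure ℝ))
  | prod A B => by
    have := instSigmaFiniteVolume A
    have := instSigmaFiniteVolume B
    exact inferInstanceAs (SigmaFinite ((volume : Measure A.Carrier).prod (volume : Measure B.Carrier)))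
  | power A n => by
    have := instSigmaFiniteVolume A
    exact inferInstanceAs (SigmaFinite (Measure.pi fun _ : Fin n => (volume : Measure A.Carrier)))

instance instMeasurableSingletonClassCarrier : (A : Space) → MeasurableSingletonClass A.Carrier
  | finite k => @MeasurableSingletonClass.mk (Fin (k + 1)) ⊤ fun _ => trivial
  | real => inferInstanceAs (MeasurableSingletonClass ℝ)
  | prod A B => by
    have := instMeasurableSingletonClassCarrier A
    have := instMeasurableSingletonClassCarrier B
    exact inferInstanceAs (MeasurableSingletonClass (A.Carrier × B.Carrier))
  | power A n => by
    have := instMeasurableSingletonClassCarrier A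
    exact inferInstanceAs (MeasurableSingletonClass (Fin n → A.Carrier))

instance (A B : Space) [h : Finite A] [h' : Finite B] : Finite (A.prod B) :=
  inferInstanceAs (Finite (A.Carrier × B.Carrier))

instance (A : Space) [h : Finite A] (n : ℕ) : Finite (A.power n) :=
  inferInstanceAs (Finite (Fin n → A.Carrier))

instance (k : ℕ) : Finite (finite k) := inferInstanceAs (Finite (Fin (k + 1)))

lemma volume_singleton : ∀ (A : Space) [Finite A] (x : A), volume ({x} : Set A) = 1
  | finite k, _, x => by
    let _ : MeasurableSpace (Fin (k + 1)) := ⊤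
    have : MeasurableSingletonClass (Fin (k + 1)) := ⟨fun _ => trivial⟩
    exact Measure.count_singleton (α := Fin (k + 1)) x
  | real, h, _ => (not_finite_iff_infinite.2 (inferInstanceAs (Infinite ℝ)) h).elim
  | prod A B, h, x => by
    have : Finite (A.Carrier × B.Carrier) := h
    have : Finite A := Finite.of_surjective (Prod.fst : A.Carrier × B.Carrier → A.Carrier)
      Prod.fst_surjective
    have : Finite B := Finite.of_surjective (Prod.snd : A.Carrier × B.Carrier → B.Carrier)
      Prod.snd_surjective
    have := Measure.prod_prod (μ := (volume : Measure A.Carrier)) (ν := (volume : Measure B.Carrier))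
      {x.1} {x.2}
    rw [Set.singleton_prod_singleton, volume_singleton A, volume_singleton B, one_mul] at this
    exact this
  | power A n, h, x => by
    have := Measure.pi_pi (fun _ : Fin n => (volume : Measure A.Carrier)) fun i => {x i}
    have e : (Set.univ.pi fun i : Fin n => ({x i} : Set A.Carrier)) = {x} :=
      Set.univ_pi_singleton (ι := Fin n) (α := fun _ => A.Carrier) x
    rw [e] at this
    -- `A` need not be finite when `n = 0`; its finiteness is derived only after an index `i` is at
    -- hand.
    refine this.trans (Finset.prod_eq_one fun i _ => ?_)
    have : Finite (Fin n → A.Carrier) := h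
    have : Finite A := Finite.of_surjective (fun f : Fin n → A.Carrier => f i)
      (Function.surjective_eval i)
    exact volume_singleton A (x i)

lemma integral_eq_sum (A : Space) [Fintype A] (f : A → ℝ) : ∫ x : A, f x = ∑ x, f x := by
  have : IsFiniteMeasure (volume : Measure A) := ⟨by
    rw [← Set.biUnion_of_singleton (Set.univ : Set A)]
    refine (measure_biUnion_lt_top Set.finite_univ fun x _ => ?_)
    rw [volume_singleton]; exact ENNReal.one_lt_top⟩
  rw [integral_fintype (Integrable.of_finite)]
  simp [Measure.real, volume_singleton]

lemma lintegral_eq_sum (A : Space) [Fintype A] (f : A → ℝ≥0∞) : ∫⁻ x : A, f x = ∑ x, f x := by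
  rw [lintegral_fintype]
  simp [volume_singleton]

instance : Unique (finite 0) := inferInstanceAs (Unique (Fin 1))

lemma lintegral_finite_zero (f : finite 0 → ℝ≥0∞) : ∫⁻ r, f r = f default := by
  rw [lintegral_unique, ← Set.eq_univ_of_forall (s := {(default : finite 0)}) Unique.eq_default,
    volume_singleton, mul_one]

end Space

/-! ### Densities and local data -/

section Density

variable {B : Space} {p δ : B → ℝ}

lemma IsDensity.of_integral (hm : Measurable p) (h0 : ∀ y, 0 ≤ p y) (hi : Integrable p)
    (h1 : ∫ y, p y = 1) : IsDensity p :=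
  ⟨hm, h0, by rw [← ofReal_integral_eq_lintegral_ofReal hi (ae_of_all _ h0), h1]; simp⟩

lemma IsDensity.integrable (h : IsDensity p) : Integrable p :=
  (lintegral_ofReal_ne_top_iff_integrable h.measurable.aestronglyMeasurable
    (ae_of_all _ h.nonneg)).1 (by rw [h.lintegral_eq_one]; simp)

lemma IsDensity.integral_eq_one (h : IsDensity p) : ∫ y, p y = 1 := by
  rw [integral_eq_lintegral_of_nonneg_ae (ae_of_all _ h.nonneg) h.measurable.aestronglyMeasurable,
    h.lintegral_eq_one]; simp

lemma IsDensity.isProbabilityMeasure_law (h : IsDensity p) : IsProbabilityMeasure (law p) :=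
  ⟨by simpa [law] using h.lintegral_eq_one⟩

lemma IsDensity.integral_law (h : IsDensity p) (f : B → ℝ) :
    ∫ y, f y ∂(law p) = ∫ y, p y * f y := by
  rw [law, integral_withDensity_eq_integral_toReal_smul h.measurable.ennreal_ofReal
    (ae_of_all _ fun _ => ENNReal.ofReal_lt_top)]
  simp [ENNReal.toReal_ofReal (h.nonneg _)]

lemma IsDensity.integrable_law_iff (h : IsDensity p) (f : B → ℝ) :
    Integrable f (law p) ↔ Integrable fun y => p y * f y := by
  rw [law, integrable_withDensity_iff_integrable_smul' h.measurable.ennreal_ofReal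
    (ae_of_all _ fun _ => ENNReal.ofReal_lt_top)]
  simp [ENNReal.toReal_ofReal (h.nonneg _)]

lemma IsDensity.lintegral_law (h : IsDensity p) {f : B → ℝ≥0∞} (hf : Measurable f) :
    ∫⁻ y, f y ∂(law p) = ∫⁻ y, ENNReal.ofReal (p y) * f y := by
  rw [law, lintegral_withDensity_eq_lintegral_mul _ h.measurable.ennreal_ofReal hf]
  rfl

/-- `δ` is a tangent vector at the probability density `p`. -/
structure IsLocalTangent (p δ : B → ℝ) : Prop where
  measurable : Measurable δ
  integrable : Integrable δ
  integral_eq_zero : ∫ y, δ y = 0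
  fisher_lt_top : fisher p δ < ∞

lemma IsLocalTangent.measurable_score (h : IsLocalTangent p δ) (hp : IsDensity p) :
    Measurable (score p δ) := h.measurable.div hp.measurable

/-- Where `p = 0` and `δ ≠ 0` the integrand of the Fisher information is `∞`, so finiteness makes
this set negligible. -/
lemma IsLocalTangent.ae_eq (h : IsLocalTangent p δ) (hp : IsDensity p) :
    ∀ᵐ y, δ y = p y * score p δ y := by
  have hm : Measurable fun y => ENNReal.ofReal (δ y ^ 2) / ENNReal.ofReal (p y) :=
    ((h.measurable.pow_const 2).ennreal_ofReal).div hp.measurable.ennreal_ofReal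
  filter_upwards [ae_lt_top hm h.fisher_lt_top.ne] with y hy
  rcases eq_or_ne (p y) 0 with h0 | h0
  · rw [h0, zero_mul]
    by_contra hδ
    rw [h0, ENNReal.ofReal_zero, ENNReal.div_zero] at hy
    · exact lt_irrefl _ hy
    · exact (ENNReal.ofReal_pos.2 (by positivity)).ne'
  · rw [score, mul_div_cancel₀ _ h0]

lemma fisher_eq_lintegral_law (hp : IsDensity p) (hm : Measurable δ)
    (h : ∀ᵐ y, δ y = p y * score p δ y) :
    fisher p δ = ∫⁻ y, ENNReal.ofReal (score p δ y ^ 2) ∂(law p) := by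
  rw [hp.lintegral_law (by exact ((hm.div hp.measurable).pow_const 2).ennreal_ofReal), fisher]
  refine lintegral_congr_ae ?_
  filter_upwards [h] with y hy
  rcases (hp.nonneg y).eq_or_lt' with h0 | h0
  · simp [hy, h0]
  · rw [← ENNReal.ofReal_div_of_pos h0, ← ENNReal.ofReal_mul h0.le, score]
    congr 1
    field_simp

lemma IsLocalTangent.memLp_score (h : IsLocalTangent p δ) (hp : IsDensity p) :
    MemLp (score p δ) 2 (law p) := by
  refine (memLp_two_iff_integrable_sq (h.measurable_score hp).aestronglyMeasurable).2 ?_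
  refine (lintegral_ofReal_ne_top_iff_integrable
    ((h.measurable_score hp).pow_const 2).aestronglyMeasurable
    (ae_of_all _ fun _ => sq_nonneg _)).1 ?_
  rw [← fisher_eq_lintegral_law hp h.measurable (h.ae_eq hp)]
  exact h.fisher_lt_top.ne

lemma IsLocalTangent.integral_score (h : IsLocalTangent p δ) (hp : IsDensity p) :
    ∫ y, score p δ y ∂(law p) = 0 := by
  rw [hp.integral_law, ← h.integral_eq_zero]
  exact integral_congr_ae ((h.ae_eq hp).mono fun _ hy => hy.symm)

lemma IsLocalTangent.integral_score_sq (h : IsLocalTangent p δ) (hp : IsDensity p) :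
    ∫ y, score p δ y ^ 2 ∂(law p) = (fisher p δ).toReal := by
  rw [fisher_eq_lintegral_law hp h.measurable (h.ae_eq hp),
    integral_eq_lintegral_of_nonneg_ae (ae_of_all _ fun _ => sq_nonneg _)
      ((h.measurable_score hp).pow_const 2).aestronglyMeasurable]

/-- Multiplying a density by a centred square-integrable function gives a tangent vector. -/
lemma isLocalTangent_of_ae_eq {L : B → ℝ} (hp : IsDensity p) (hm : Measurable δ) (hLm : Measurable L)
    (hL : MemLp L 2 (law p)) (h0 : ∫ y, L y ∂(law p) = 0) (h : ∀ᵐ y, δ y = p y * L y) :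
    IsLocalTangent p δ ∧ fisher p δ = ∫⁻ y, ENNReal.ofReal (L y ^ 2) ∂(law p) := by
  have := hp.isProbabilityMeasure_law
  have hf : fisher p δ = ∫⁻ y, ENNReal.ofReal (L y ^ 2) ∂(law p) := by
    rw [hp.lintegral_law (by exact (hLm.pow_const 2).ennreal_ofReal), fisher]
    refine lintegral_congr_ae ?_
    filter_upwards [h] with y hy
    rcases (hp.nonneg y).eq_or_lt' with h0 | h0
    · simp [hy, h0]
    · rw [← ENNReal.ofReal_div_of_pos h0, ← ENNReal.ofReal_mul h0.le, hy]
      congr 1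
      field_simp
  refine ⟨⟨hm, ?_, ?_, ?_⟩, hf⟩
  · exact ((hp.integrable_law_iff L).1 (hL.integrable one_le_two)).congr
      (h.mono fun _ hy => hy.symm)
  · rw [integral_congr_ae h, ← hp.integral_law, h0]
  · rw [hf]
    exact (lintegral_ofReal_ne_top_iff_integrable (hLm.pow_const 2).aestronglyMeasurable
      (ae_of_all _ fun _ => sq_nonneg _)).2 hL.integrable_sq |>.lt_top

/-- The **Cauchy–Schwarz inequality** for a statistic and the score. -/
lemma IsLocalTangent.sq_integral_mul_le (h : IsLocalTangent p δ) (hp : IsDensity p) {f : B → ℝ}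
    (hf : MemLp f 2 (law p)) :
    (∫ y, f y * δ y) ^ 2 ≤ (fisher p δ).toReal * ∫ y, p y * f y ^ 2 := by
  have e : ∫ y, f y * δ y = ∫ y, f y * score p δ y ∂(law p) := by
    rw [hp.integral_law]
    refine integral_congr_ae ((h.ae_eq hp).mono fun y hy => ?_)
    simp only [hy]; ring
  rw [e, ← h.integral_score_sq hp, ← hp.integral_law, mul_comm]
  have hL := h.memLp_score hp
  -- The quadratic polynomial `t ↦ 𝔼 (t f + L)²` is nonnegative, so its discriminant is at most
  -- zero.
  have key : ∀ t : ℝ, 0 ≤ (∫ y, f y ^ 2 ∂(law p)) * (t * t)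
      + (2 * ∫ y, f y * score p δ y ∂(law p)) * t + ∫ y, score p δ y ^ 2 ∂(law p) := by
    intro t
    have : 0 ≤ ∫ y, (t * f y + score p δ y) ^ 2 ∂(law p) := integral_nonneg fun _ => sq_nonneg _
    have e2 : ∀ y, (t * f y + score p δ y) ^ 2
        = (t * t) * f y ^ 2 + (2 * t) * (f y * score p δ y) + score p δ y ^ 2 := fun y => by ring
    simp_rw [e2] at this
    have i1 := hf.integrable_sq
    have i2 : Integrable (fun y => f y * score p δ y) (law p) := hf.integrable_mul hL
    have i3 := hL.integrable_sq
    have i12 : Integrable (fun y => t * t * f y ^ 2 + 2 * t * (f y * score p δ y)) (law p) :=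
      (i1.const_mul _).add (i2.const_mul _)
    rw [integral_add i12 i3, integral_add (i1.const_mul _) (i2.const_mul _), integral_const_mul,
      integral_const_mul] at this
    linarith
  have := discrim_le_zero key
  rw [discrim] at this
  nlinarith

end Density

/-! ### Tangent vectors at channels and tensor powers -/

section Channel

variable {A B : Space} {Φ Δ : A → B → ℝ}

lemma IsTangent.isLocalTangent (h : IsTangent Φ Δ) (x : A) : IsLocalTangent (Φ x) (Δ x) := by
  obtain ⟨⟨c, Ψ₁, Ψ₂, h₁, h₂, e⟩, hf⟩ := h
  have e' : Δ x = fun y => c * (Ψ₁ x y - Ψ₂ x y) := funext fun y => e x y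
  refine ⟨?_, ?_, ?_, hf x⟩ <;> rw [e']
  · exact ((h₁ x).measurable.sub (h₂ x).measurable).const_mul c
  · exact ((h₁ x).integrable.sub (h₂ x).integrable).const_mul c
  · rw [integral_const_mul, integral_sub (h₁ x).integrable (h₂ x).integrable,
      (h₁ x).integral_eq_one, (h₂ x).integral_eq_one, sub_self, mul_zero]

/-- The positive and negative parts of `Δ x` have the same mass `m x`. Padding both with `(c - m x)
Φ x` and dividing by `c` turns them into channels whose difference is `Δ / c`. Finiteness of the
input set provides a `c` that works for all inputs. -/
lemma isTangent_of_isLocalTangent [Finite A] (hΦ : IsChannel Φ)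
    (h : ∀ x, IsLocalTangent (Φ x) (Δ x)) : IsTangent Φ Δ := by
  have := Fintype.ofFinite A
  let m : A → ℝ := fun x => ∫ y, max (Δ x y) 0
  have hm0 : ∀ x, 0 ≤ m x := fun x => integral_nonneg fun y => le_max_right _ _
  have hi : ∀ x, Integrable fun y => max (Δ x y) 0 := fun x => (h x).integrable.pos_part
  have hi' : ∀ x, Integrable fun y => max (-Δ x y) 0 := fun x => (h x).integrable.neg_part
  have hm' : ∀ x, ∫ y, max (-Δ x y) 0 = m x := by
    intro x
    have e : ∀ y, Δ x y = max (Δ x y) 0 - max (-Δ x y) 0 := fun y => by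
      rcases le_total (Δ x y) 0 with h0 | h0
      · rw [max_eq_right h0, max_eq_left (by linarith)]; ring
      · rw [max_eq_left h0, max_eq_right (by linarith)]; ring
    have := (h x).integral_eq_zero
    rw [integral_congr_ae (ae_of_all _ e), integral_sub (hi x) (hi' x)] at this
    simp only [m]; linarith
  -- Any common strict bound of the `m x` would do; the summand `1` also makes `c` positive.
  let c : ℝ := 1 + ∑ x, m x
  have hmc : ∀ x, m x < c := fun x => by
    have := Finset.single_le_sum (f := m) (fun x _ => hm0 x) (Finset.mem_univ x)
    simp only [c]; linarith
  have hc : 0 < c := by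
    have := Finset.sum_nonneg fun x (_ : x ∈ Finset.univ) => hm0 x
    simp only [c]; linarith
  have key : ∀ (f : A → B → ℝ), (∀ x, Measurable (f x)) → (∀ x y, 0 ≤ f x y) →
      (∀ x, Integrable (f x)) → (∀ x, ∫ y, f x y = m x) →
      IsChannel fun x y => c⁻¹ * (f x y + (c - m x) * Φ x y) := by
    intro f f1 f2 f3 f4 x
    refine .of_integral (((f1 x).add ((hΦ x).measurable.const_mul _)).const_mul _) (fun y => ?_)
      (((f3 x).add ((hΦ x).integrable.const_mul _)).const_mul _) ?_
    · have := (hΦ x).nonneg y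
      have := f2 x y
      have := hmc x
      have : 0 ≤ (c - m x) * Φ x y := mul_nonneg (by linarith) ((hΦ x).nonneg y)
      positivity
    · rw [integral_const_mul, integral_add (f3 x) ((hΦ x).integrable.const_mul _),
        integral_const_mul, f4, (hΦ x).integral_eq_one]
      field_simp; ring
  refine ⟨⟨c, _, _, key (fun x y => max (Δ x y) 0) (fun x => (h x).measurable.max measurable_const)
    (fun x y => le_max_right _ _) hi (fun x => rfl), key (fun x y => max (-Δ x y) 0)
    (fun x => (h x).measurable.neg.max measurable_const) (fun x y => le_max_right _ _) hi' hm',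
    fun x y => ?_⟩, fun x => (h x).fisher_lt_top⟩
  field_simp
  rcases le_total (Δ x y) 0 with h0 | h0
  · rw [max_eq_right h0, max_eq_left (by linarith)]; ring
  · rw [max_eq_left h0, max_eq_right (by linarith)]; ring

variable {n : ℕ}

lemma IsChannel.tensorPow (hΦ : IsChannel Φ) (n : ℕ) : IsChannel (tensorPow Φ n) := by
  intro x
  have hm : Measurable (_root_.tensorPow Φ n x) :=
    Finset.measurable_fun_prod _ fun i _ => (hΦ (x i)).measurable.comp (measurable_pi_apply i)
  refine .of_integral hm (fun y => Finset.prod_nonneg fun i _ => (hΦ (x i)).nonneg _) ?_ ?_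
  · exact Integrable.fintype_prod (ι := Fin n) (f := fun i => Φ (x i))
      fun i => (hΦ (x i)).integrable
  · refine (integral_fintype_prod_volume_eq_prod (ι := Fin n) fun i => Φ (x i)).trans ?_
    exact Finset.prod_eq_one fun i _ => (hΦ (x i)).integral_eq_one

/-- Makes the coordinates independent random variables, so that variances add and characteristic
functions multiply. It is checked on boxes. -/
lemma law_tensorPow (hΦ : IsChannel Φ) (x : A.power n) :
    law (tensorPow Φ n x) = Measure.pi fun i => law (Φ (x i)) := by
  have := fun i => (hΦ (x i)).isProbabilityMeasure_law
  have := (hΦ.tensorPow n x).isProbabilityMeasure_law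
  symm
  refine Measure.pi_eq fun s hs => ?_
  -- The box is replaced by a set `S` known only through its members, because `B.power n` and the
  -- function type agree only after unfolding.
  suffices key : ∀ S : Set (B.power n), MeasurableSet S → (∀ y, y ∈ S ↔ ∀ i : Fin n, y i ∈ s i) →
      (law (tensorPow Φ n x)).real S = ∏ i, (law (Φ (x i))).real (s i) from
    (ENNReal.toReal_eq_toReal_iff' (measure_ne_top (law (tensorPow Φ n x)) _)
      (ENNReal.prod_ne_top fun i _ => measure_ne_top _ _)).1
        ((key (Set.univ.pi s) (MeasurableSet.univ_pi hs) fun y => Set.mem_univ_pi).trans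
          (ENNReal.toReal_prod _ _).symm)
  intro S hS hmem
  rw [← integral_indicator_one hS, (hΦ.tensorPow n x).integral_law]
  have e : ∀ y : B.power n, tensorPow Φ n x y * S.indicator 1 y
      = ∏ i : Fin n, Φ (x i) (y i) * (s i).indicator 1 (y i) := fun y => by
    rw [Finset.prod_mul_distrib]
    congr 1
    by_cases h : ∀ i : Fin n, y i ∈ s i
    · rw [Set.indicator_of_mem ((hmem y).2 h), Finset.prod_eq_one]
      · rfl
      · intro i _
        rw [Set.indicator_of_mem (h i)]; rfl
    · rw [Set.indicator_of_notMem (mt (hmem y).1 h)]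
      push Not at h
      obtain ⟨i, hi⟩ := h
      exact (Finset.prod_eq_zero (Finset.mem_univ i) (Set.indicator_of_notMem hi _)).symm
  simp_rw [e]
  refine (integral_fintype_prod_volume_eq_prod (ι := Fin n)
    fun i y => Φ (x i) y * (s i).indicator 1 y).trans ?_
  refine Finset.prod_congr rfl fun i _ => ?_
  rw [← (hΦ (x i)).integral_law, integral_indicator_one (hs i)]

/-- The sum of the scores of the coordinates. -/
def scoreSum (Φ Δ : A → B → ℝ) (n : ℕ) (x : A.power n) (y : B.power n) : ℝ :=
  ∑ i : Fin n, score (Φ (x i)) (Δ (x i)) (y i)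

lemma measurable_scoreSum (hΦ : IsChannel Φ) (hΔ : IsTangent Φ Δ) (x : A.power n) :
    Measurable (scoreSum Φ Δ n x) :=
  Finset.measurable_fun_sum _ fun i _ =>
    ((hΔ.isLocalTangent (x i)).measurable_score (hΦ (x i))).comp (measurable_pi_apply i)

/-- The logarithmic derivative of a product is the sum of the logarithmic derivatives. The
exceptional null sets of the coordinates pull back to null sets. -/
lemma tangentPow_ae_eq (hΦ : IsChannel Φ) (hΔ : IsTangent Φ Δ) (x : A.power n) :
    ∀ᵐ y, tangentPow Φ Δ n x y = tensorPow Φ n x y * scoreSum Φ Δ n x y := by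
  have h : ∀ i : Fin n, ∀ᵐ y : B.power n,
      Δ (x i) (y i) = Φ (x i) (y i) * score (Φ (x i)) (Δ (x i)) (y i) := fun i =>
    (Measure.quasiMeasurePreserving_eval (fun _ : Fin n => (volume : Measure B)) i).ae
      ((hΔ.isLocalTangent (x i)).ae_eq (hΦ (x i)))
  filter_upwards [ae_all_iff.2 h] with y hy
  rw [scoreSum, Finset.mul_sum]
  refine Finset.sum_congr rfl fun i _ => ?_
  rw [hy i, tensorPow, ← Finset.mul_prod_erase _ _ (Finset.mem_univ i)]
  ring

lemma memLp_scoreSum (hΦ : IsChannel Φ) (hΔ : IsTangent Φ Δ) (x : A.power n) :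
    MemLp (scoreSum Φ Δ n x) 2 (law (tensorPow Φ n x)) := by
  have := fun i => (hΦ (x i)).isProbabilityMeasure_law
  rw [law_tensorPow hΦ]
  exact memLp_finsetSum (ι := Fin n) _ fun i _ =>
    ((hΔ.isLocalTangent (x i)).memLp_score (hΦ (x i))).comp_measurePreserving
      (measurePreserving_eval (fun i => law (Φ (x i))) i)

lemma integral_scoreSum (hΦ : IsChannel Φ) (hΔ : IsTangent Φ Δ) (x : A.power n) :
    ∫ y, scoreSum Φ Δ n x y ∂(law (tensorPow Φ n x)) = 0 := by
  have := fun i => (hΦ (x i)).isProbabilityMeasure_law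
  rw [law_tensorPow hΦ]
  have hi : ∀ i : Fin n, Integrable (fun y : Fin n → B => score (Φ (x i)) (Δ (x i)) (y i))
      (Measure.pi fun i => law (Φ (x i))) := fun i =>
    integrable_comp_eval (((hΔ.isLocalTangent (x i)).memLp_score (hΦ (x i))).integrable one_le_two)
  refine (integral_finsetSum (ι := Fin n) _ fun i _ => hi i).trans ?_
  refine Finset.sum_eq_zero fun i _ => ?_
  have := (measurePreserving_eval (fun i => law (Φ (x i))) i).map_eq
  have e := integral_map (μ := Measure.pi fun i => law (Φ (x i)))
    (φ := Function.eval i) (f := score (Φ (x i)) (Δ (x i))) (measurable_pi_apply i).aemeasurable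
    ((hΔ.isLocalTangent (x i)).measurable_score (hΦ (x i))).aestronglyMeasurable
  rw [this, (hΔ.isLocalTangent (x i)).integral_score (hΦ (x i))] at e
  exact e.symm

lemma integral_scoreSum_sq (hΦ : IsChannel Φ) (hΔ : IsTangent Φ Δ) (x : A.power n) :
    ∫ y, scoreSum Φ Δ n x y ^ 2 ∂(law (tensorPow Φ n x))
      = ∑ i : Fin n, (fisher (Φ (x i)) (Δ (x i))).toReal := by
  have := fun i => (hΦ (x i)).isProbabilityMeasure_law
  rw [← variance_of_integral_eq_zero (measurable_scoreSum hΦ hΔ x).aemeasurable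
    (integral_scoreSum hΦ hΔ x), law_tensorPow hΦ]
  have e := variance_sum_pi (μ := fun i : Fin n => law (Φ (x i)))
    (X := fun i => score (Φ (x i)) (Δ (x i)))
    fun i => (hΔ.isLocalTangent (x i)).memLp_score (hΦ (x i))
  have e2 : (∑ i : Fin n, fun ω : Fin n → B => score (Φ (x i)) (Δ (x i)) (ω i))
      = scoreSum Φ Δ n x := by
    ext y; rw [Finset.sum_apply]; rfl
  rw [e2] at e
  refine e.trans (Finset.sum_congr rfl fun i _ => ?_)
  rw [variance_of_integral_eq_zero
    ((hΔ.isLocalTangent (x i)).measurable_score (hΦ (x i))).aemeasurable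
    ((hΔ.isLocalTangent (x i)).integral_score (hΦ (x i))),
    (hΔ.isLocalTangent (x i)).integral_score_sq (hΦ (x i))]

lemma measurable_tangentPow (hΦ : IsChannel Φ) (hΔ : IsTangent Φ Δ) (x : A.power n) :
    Measurable (tangentPow Φ Δ n x) :=
  Finset.measurable_fun_sum _ fun i _ =>
    ((hΔ.isLocalTangent (x i)).measurable.comp (measurable_pi_apply i)).mul
      (Finset.measurable_fun_prod _ fun j _ => (hΦ (x j)).measurable.comp (measurable_pi_apply j))

lemma isLocalTangent_tangentPow (hΦ : IsChannel Φ) (hΔ : IsTangent Φ Δ) (x : A.power n) :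
    IsLocalTangent (tensorPow Φ n x) (tangentPow Φ Δ n x) :=
  (isLocalTangent_of_ae_eq (hΦ.tensorPow n x) (measurable_tangentPow hΦ hΔ x)
    (measurable_scoreSum hΦ hΔ x) (memLp_scoreSum hΦ hΔ x) (integral_scoreSum hΦ hΔ x)
    (tangentPow_ae_eq hΦ hΔ x)).1

/-- Additivity of the Fisher information: the scores of the coordinates are independent and centred,
so the variance of their sum is the sum of the variances. -/
lemma fisher_tangentPow (hΦ : IsChannel Φ) (hΔ : IsTangent Φ Δ) (x : A.power n) :
    (fisher (tensorPow Φ n x) (tangentPow Φ Δ n x)).toReal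
      = ∑ i : Fin n, (fisher (Φ (x i)) (Δ (x i))).toReal := by
  rw [(isLocalTangent_of_ae_eq (hΦ.tensorPow n x) (measurable_tangentPow hΦ hΔ x)
    (measurable_scoreSum hΦ hΔ x) (memLp_scoreSum hΦ hΔ x) (integral_scoreSum hΦ hΔ x)
    (tangentPow_ae_eq hΦ hΔ x)).2, ← integral_scoreSum_sq hΦ hΔ x,
    integral_eq_lintegral_of_nonneg_ae (ae_of_all _ fun _ => sq_nonneg _)
      ((measurable_scoreSum hΦ hΔ x).pow_const 2).aestronglyMeasurable]

lemma IsTangent.tangentPow [Finite A] (hΦ : IsChannel Φ) (hΔ : IsTangent Φ Δ) (n : ℕ) :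
    IsTangent (tensorPow Φ n) (tangentPow Φ Δ n) :=
  isTangent_of_isLocalTangent (hΦ.tensorPow n) (isLocalTangent_tangentPow hΦ hΔ)

end Channel

/-! ### Markov maps given by densities, and the completely bounded norm -/

section Kernels

variable {B B' : Space} {k : B → B' → ℝ}

/-- The Markov map with transition density `k`. -/
def densityKernel (k : B → B' → ℝ) : Kernel B B' :=
  (Kernel.const B (volume : Measure B')).withDensity fun y z => ENNReal.ofReal (k y z)

lemma densityKernel_apply (hk : Measurable (Function.uncurry k)) (y : B) :
    densityKernel k y = law (k y) := by
  rw [densityKernel, Kernel.withDensity_apply _ (by exact hk.ennreal_ofReal)]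
  rfl

lemma isMarkovMap_densityKernel (hk : Measurable (Function.uncurry k)) (h : ∀ y, IsDensity (k y)) :
    IsMarkovMap (densityKernel k) := by
  refine ⟨⟨fun y => ?_⟩, ?_⟩
  · rw [densityKernel_apply hk]
    exact (h y).isProbabilityMeasure_law
  · refine Measure.AbsolutelyContinuous.mk fun s hs h0 => ?_
    rw [Measure.bind_apply hs (Kernel.aemeasurable _)]
    refine lintegral_eq_zero_of_ae_eq_zero (ae_of_all _ fun y => ?_)
    change densityKernel k y s = 0
    rw [densityKernel_apply hk]
    exact withDensity_absolutelyContinuous _ _ h0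

/-- Fubini's theorem; joint integrability holds because every `k y` has mass one. -/
lemma isImage_densityKernel (hk : Measurable (Function.uncurry k)) (h : ∀ y, IsDensity (k y))
    {f : B → ℝ} {g : B' → ℝ} (hf : Integrable f) (hg : ∀ z, g z = ∫ y, k y z * f y) :
    IsImage (densityKernel k) f g := by
  intro S hS
  have hi : Integrable (fun w : B × B' => k w.1 w.2 * f w.1)
      ((volume : Measure B).prod (volume : Measure B')) := by
    have hm : AEStronglyMeasurable (fun w : B × B' => k w.1 w.2 * f w.1)
        ((volume : Measure B).prod (volume : Measure B')) :=
      (hk.aestronglyMeasurable).mul hf.aestronglyMeasurable.comp_fst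
    refine (integrable_prod_iff hm).2 ⟨ae_of_all _ fun y => (h y).integrable.mul_const (f y), ?_⟩
    refine hf.norm.congr (ae_of_all _ fun y => ?_)
    simp only [norm_mul, Real.norm_of_nonneg ((h y).nonneg _)]
    rw [integral_mul_const, (h y).integral_eq_one, one_mul]
  have hi' : Integrable (Function.uncurry fun (z : B') (y : B) => k y z * f y)
      (((volume : Measure B').restrict S).prod (volume : Measure B)) := by
    refine hi.swap.mono_measure ?_
    have : (volume : Measure B) = (volume : Measure B).restrict Set.univ := by simp
    rw [this, Measure.prod_restrict]
    exact Measure.restrict_le_self.trans (by simp)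
  simp_rw [hg]
  rw [integral_integral_swap hi']
  refine integral_congr_ae (ae_of_all _ fun y => ?_)
  simp only
  rw [integral_mul_const, densityKernel_apply hk]
  congr 1
  rw [Measure.real, law, withDensity_apply _ hS, integral_eq_lintegral_of_nonneg_ae
    (ae_of_all _ (h y).nonneg) (h y).measurable.aestronglyMeasurable]

end Kernels

section CbNorm

variable {A B : Space} {Λ : A → B → ℝ}

/-- Together with `le_cbNorm` this identifies the norm with the largest `L¹` norm over the inputs.
For a classical finite input the ancilla gives no advantage, since by the triangle inequality the
outputs are averaged with weights of total mass one. -/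
lemma cbNorm_le [Finite A] (hm : ∀ x, Measurable (Λ x)) {C : ℝ≥0∞}
    (h : ∀ x, ∫⁻ y, ‖Λ x y‖ₑ ≤ C) : cbNorm Λ ≤ C := by
  have := Fintype.ofFinite A
  refine iSup_le fun R => iSup_le fun p => iSup_le fun hp => ?_
  have hpm : ∀ x, Measurable fun r : R => p (x, r) := fun x =>
    hp.measurable.comp measurable_prodMk_left
  calc ∫⁻ z : B.prod R, ‖∫ x : A, Λ x z.1 * p (x, z.2)‖ₑ
      ≤ ∫⁻ z : B.prod R, ∑ x : A, ‖Λ x z.1‖ₑ * ENNReal.ofReal (p (x, z.2)) := by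
        refine lintegral_mono fun z => ?_
        simp only
        rw [Space.integral_eq_sum]
        refine (enorm_sum_le _ _).trans (Finset.sum_le_sum fun x _ => ?_)
        rw [enorm_mul]
        exact (congrArg _ (Real.enorm_of_nonneg (hp.nonneg _))).le
    _ = ∑ x : A, (∫⁻ y, ‖Λ x y‖ₑ) * ∫⁻ r : R, ENNReal.ofReal (p (x, r)) := by
        rw [lintegral_finsetSum]
        · refine Finset.sum_congr rfl fun x _ => ?_
          exact lintegral_prod_mul (μ := (volume : Measure B)) (ν := (volume : Measure R))
            (hm x).enorm.aemeasurable (hpm x).ennreal_ofReal.aemeasurable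
        · intro x _
          exact ((hm x).enorm.comp measurable_fst).mul
            ((hpm x).ennreal_ofReal.comp measurable_snd)
    _ ≤ ∑ x : A, C * ∫⁻ r : R, ENNReal.ofReal (p (x, r)) :=
        Finset.sum_le_sum fun x _ => mul_le_mul_left (h x) _
    _ = C := by
        rw [← Finset.mul_sum, ← Space.lintegral_eq_sum]
        have e := lintegral_prod (μ := (volume : Measure A)) (ν := (volume : Measure R))
          (fun w => ENNReal.ofReal (p w)) hp.measurable.ennreal_ofReal.aemeasurable
        rw [← e]
        exact (congrArg (C * ·) hp.lintegral_eq_one).trans (mul_one C)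

lemma le_cbNorm [Finite A] (hm : ∀ x, Measurable (Λ x)) (x : A) :
    ∫⁻ y, ‖Λ x y‖ₑ ≤ cbNorm Λ := by
  classical
  have := Fintype.ofFinite A
  -- The point mass at the input `x`, with a one-point ancilla.
  let p : A.prod (.finite 0) → ℝ := fun w => if w.1 = x then 1 else 0
  have hp : IsDensity p := by
    have hpm : Measurable p := measurable_of_finite _
    refine ⟨hpm, fun w => ?_, ?_⟩
    · simp only [p]; split_ifs <;> norm_num
    · refine (lintegral_prod (μ := (volume : Measure A)) (ν := (volume : Measure (Space.finite 0)))
          (fun w => ENNReal.ofReal (p w)) hpm.ennreal_ofReal.aemeasurable).trans ?_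
      simp_rw [Space.lintegral_finite_zero]
      rw [Space.lintegral_eq_sum]
      have : ∀ x' : A, ENNReal.ofReal (p (x', default)) = if x' = x then 1 else 0 := by
        intro x'; simp only [p]; split_ifs <;> simp
      simp_rw [this]
      simp
  refine le_trans ?_ (le_iSup_of_le (.finite 0) (le_iSup_of_le p (le_iSup_of_le hp le_rfl)))
  have e : ∀ z : B.prod (.finite 0), ∫ x' : A, Λ x' z.1 * p (x', z.2) = Λ x z.1 := fun z => by
    rw [Space.integral_eq_sum]
    simp [p]
  simp_rw [e]
  refine le_of_eq ?_
  refine Eq.trans ?_ (lintegral_prod (μ := (volume : Measure B)) (ν := (volume : Measure (Space.finite 0)))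
    (fun z => ‖Λ x z.1‖ₑ) ((hm x).enorm.comp measurable_fst).aemeasurable).symm
  simp_rw [Space.lintegral_finite_zero]

end CbNorm

/-! ### Comparison of metrics along approximations -/

/-- A diagonal argument: objects that are eventually `ε`-good for each `ε` can be chosen uniformly
in `ε`. -/
lemma exists_seq_eventually {X : ℕ → Type*} (d : ∀ n, X n) {P : ℝ → ∀ n, X n → Prop}
    (hmono : ∀ ε ε' n x, ε ≤ ε' → P ε n x → P ε' n x)
    (h : ∀ ε > 0, ∀ᶠ n in atTop, ∃ x, P ε n x) :
    ∃ x : ∀ n, X n, ∀ ε > 0, ∀ᶠ n in atTop, P ε n (x n) := by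
  classical
  let Q : ℕ → ℕ → Prop := fun n m => ∃ x, P (1 / ((m : ℝ) + 1)) n x
  -- The finest accuracy `1 / (m + 1)` with `m ≤ n` attainable at stage `n`; each fixed `m` is
  -- eventually a candidate, so `M n` tends to infinity.
  let M : ℕ → ℕ := fun n => Nat.findGreatest (Q n) n
  refine ⟨fun n => if h : Q n (M n) then h.choose else d n, fun ε hε => ?_⟩
  obtain ⟨m, hm⟩ := exists_nat_one_div_lt hε
  filter_upwards [h (1 / ((m : ℝ) + 1)) (by positivity), eventually_ge_atTop m] with n hn hmn
  have hQ : Q n (M n) := Nat.findGreatest_spec (P := Q n) hmn hn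
  have hle : m ≤ M n := Nat.le_findGreatest hmn hn
  rw [dif_pos hQ]
  refine hmono _ _ n _ (le_trans ?_ hm.le) hQ.choose_spec
  have : (m : ℝ) ≤ M n := by exact_mod_cast hle
  gcongr

/-- If the tensor powers of `{Φ, Δ}` are approximated by channels on which the metric is at most
`n K`, then the metric is at most `K` at `{Φ, Δ}`. -/
lemma le_of_asymptotic_approx {G : ChannelFunctional} (hA : AxiomA G) (hC : AxiomC G)
    {A B : Space} [Finite A] {Φ Δ : A → B → ℝ} (hΦ : IsChannel Φ) (hΔ : IsTangent Φ Δ) {K : ℝ}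
    (h : ∀ ε > 0, ∀ᶠ n : ℕ in atTop, ∃ Ψ Θ : A.power n → B.power n → ℝ,
      IsChannel Ψ ∧ IsTangent Ψ Θ ∧
      (∀ x, ∫⁻ y, ‖Ψ x y - tensorPow Φ n x y‖ₑ ≤ ENNReal.ofReal ε) ∧
      (∀ x, ∫⁻ y, ‖Θ x y - tangentPow Φ Δ n x y‖ₑ ≤ ENNReal.ofReal (ε * √n)) ∧
      (1 / (n : ℝ)) * G (A.power n) (B.power n) Ψ Θ ≤ K) : G A B Φ Δ ≤ K := by
  let X : ℕ → Type := fun n => {w : (A.power n → B.power n → ℝ) × (A.power n → B.power n → ℝ) //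
    IsChannel w.1 ∧ IsTangent w.1 w.2}
  let P : ℝ → ∀ n, X n → Prop := fun ε n w =>
      (∀ x, ∫⁻ y, ‖w.1.1 x y - tensorPow Φ n x y‖ₑ ≤ ENNReal.ofReal ε) ∧
      (∀ x, ∫⁻ y, ‖w.1.2 x y - tangentPow Φ Δ n x y‖ₑ ≤ ENNReal.ofReal (ε * √n)) ∧
      (1 / (n : ℝ)) * G (A.power n) (B.power n) w.1.1 w.1.2 ≤ K
  obtain ⟨w, hw⟩ := exists_seq_eventually (X := X) (P := P)
    (fun n => ⟨(tensorPow Φ n, tangentPow Φ Δ n), hΦ.tensorPow n, hΔ.tangentPow hΦ n⟩)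
    (fun ε ε' n x hε ⟨h1, h2, h3⟩ => ⟨fun x => (h1 x).trans (ENNReal.ofReal_le_ofReal hε),
      fun x => (h2 x).trans (ENNReal.ofReal_le_ofReal (by gcongr)), h3⟩)
    (fun ε hε => (h ε hε).mono fun n ⟨Ψ, Θ, h1, h2, h3⟩ => ⟨⟨(Ψ, Θ), h1, h2⟩, h3⟩)
  have hm1 : ∀ n x, Measurable ((w n).1.1 x - tensorPow Φ n x) := fun n x =>
    ((w n).2.1 x).measurable.sub (hΦ.tensorPow n x).measurable
  have hm2 : ∀ n x, Measurable ((w n).1.2 x - tangentPow Φ Δ n x) := fun n x =>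
    ((w n).2.2.isLocalTangent x).measurable.sub (measurable_tangentPow hΦ hΔ x)
  have hlim := hC A B Φ Δ hΦ hΔ (fun n => (w n).1.1) (fun n => (w n).1.2) (fun n => (w n).2.1)
    (fun n => (w n).2.2) ?_ ?_
  -- By (C), `G / n` at the tensor power exceeds `G / n` at the approximation by less than `η`
  -- eventually, hence is at most `K + η`; by (A) it tends to `G A B Φ Δ`.
  · refine le_of_forall_pos_le_add fun η hη => ?_
    have h1 : ∀ᶠ n : ℕ in atTop, ((-η : ℝ) : EReal) < (((1 / (n : ℝ)) *
        (G (A.power n) (B.power n) (w n).1.1 (w n).1.2 -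
          G (A.power n) (B.power n) (tensorPow Φ n) (tangentPow Φ Δ n)) : ℝ) : EReal) :=
      eventually_lt_of_lt_liminf (lt_of_lt_of_le (by exact_mod_cast neg_lt_zero.2 hη) hlim)
    refine le_of_tendsto (hA A B Φ Δ hΦ hΔ) ?_
    filter_upwards [h1, hw 1 one_pos] with n hn1 hn2
    have hn1' := EReal.coe_lt_coe_iff.1 hn1
    have := hn2.2.2
    rw [mul_sub] at hn1'
    linarith
  · refine ENNReal.tendsto_nhds_zero.2 fun ε hε => ?_
    rcases eq_or_ne ε ∞ with rfl | hε'
    · exact Eventually.of_forall fun _ => le_top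
    filter_upwards [hw ε.toReal (ENNReal.toReal_pos hε.ne' hε')] with n hn
    refine cbNorm_le (hm1 n) fun x => (hn.1 x).trans ?_
    rw [ENNReal.ofReal_toReal hε']
  · refine ENNReal.tendsto_nhds_zero.2 fun ε hε => ?_
    rcases eq_or_ne ε ∞ with rfl | hε'
    · exact Eventually.of_forall fun _ => le_top
    filter_upwards [hw ε.toReal (ENNReal.toReal_pos hε.ne' hε')] with n hn
    refine ENNReal.div_le_of_le_mul (cbNorm_le (hm2 n) fun x => (hn.2.1 x).trans ?_)
    rw [ENNReal.ofReal_mul ENNReal.toReal_nonneg, ENNReal.ofReal_toReal hε']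

/-! ### The central limit theorem for sums of scores -/

/-- The factors are exchanged one at a time; all the others have modulus at most one. -/
lemma norm_prod_sub_prod_le {ι : Type*} (s : Finset ι) (a b : ι → ℂ) (ha : ∀ i ∈ s, ‖a i‖ ≤ 1)
    (hb : ∀ i ∈ s, ‖b i‖ ≤ 1) : ‖∏ i ∈ s, a i - ∏ i ∈ s, b i‖ ≤ ∑ i ∈ s, ‖a i - b i‖ := by
  classical
  induction s using Finset.induction_on with
  | empty => simp
  | insert i s hi ih =>
    rw [Finset.prod_insert hi, Finset.prod_insert hi, Finset.sum_insert hi]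
    have h1 : ‖∏ j ∈ s, a j‖ ≤ 1 := by
      rw [norm_prod]
      exact Finset.prod_le_one (fun _ _ => norm_nonneg _)
        fun j hj => ha j (Finset.mem_insert_of_mem hj)
    have h2 := ih (fun j hj => ha j (Finset.mem_insert_of_mem hj))
      fun j hj => hb j (Finset.mem_insert_of_mem hj)
    have h3 := hb i (Finset.mem_insert_self _ _)
    calc ‖a i * ∏ j ∈ s, a j - b i * ∏ j ∈ s, b j‖
        = ‖(a i - b i) * ∏ j ∈ s, a j + b i * (∏ j ∈ s, a j - ∏ j ∈ s, b j)‖ := by ring_nf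
      _ ≤ ‖a i - b i‖ * ‖∏ j ∈ s, a j‖ + ‖b i‖ * ‖∏ j ∈ s, a j - ∏ j ∈ s, b j‖ := by
          refine (norm_add_le _ _).trans ?_
          rw [norm_mul, norm_mul]
      _ ≤ ‖a i - b i‖ * 1 + 1 * ∑ j ∈ s, ‖a j - b j‖ := by gcongr
      _ = _ := by ring

/-- The Taylor polynomial of order two at `0` of a characteristic function depends only on the first
two moments. -/
lemma charFun_sub_isLittleO {μ ν : Measure ℝ} [IsProbabilityMeasure μ] [IsProbabilityMeasure ν]
    (hμ : MemLp id 2 μ) (hν : MemLp id 2 ν) (h1 : ∫ t, t ∂μ = ∫ t, t ∂ν)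
    (h2 : ∫ t, t ^ 2 ∂μ = ∫ t, t ^ 2 ∂ν) :
    (fun t => charFun μ t - charFun ν t) =o[𝓝 0] fun t => t ^ 2 := by
  have key : ∀ (ρ : Measure ℝ) [IsProbabilityMeasure ρ], MemLp id 2 ρ →
      (fun t => charFun ρ t - taylorWithinEval (charFun ρ) 2 Set.univ 0 t) =o[𝓝 0]
        fun t => t ^ 2 := by
    intro ρ _ hρ
    have := taylor_isLittleO_univ (f := charFun ρ) (x₀ := 0) (n := 2) (contDiff_charFun hρ)
    simpa using this
  have e : ∀ t, taylorWithinEval (charFun μ) 2 Set.univ 0 t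
      = taylorWithinEval (charFun ν) 2 Set.univ 0 t := by
    intro t
    have a := taylorWithinEval_charFun_two_zero (P := μ) (X := id) aemeasurable_id (by simpa using hμ) t
    have b := taylorWithinEval_charFun_two_zero (P := ν) (X := id) aemeasurable_id (by simpa using hν) t
    simp only [Measure.map_id, id, Pi.pow_apply] at a b
    rw [a, b, h1, h2]
  refine ((key μ hμ).sub (key ν hν)).congr_left fun t => ?_
  rw [e]; ring

/-- The law of `T + σ W` with `W` an independent standard Gaussian variable. -/
def smearedLaw {B : Space} (q T : B → ℝ) (σ : ℝ) : Measure ℝ :=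
  ((law q).prod (gaussianReal 0 1)).map fun w => T w.1 + σ * w.2

section Smeared

variable {B : Space} {q T : B → ℝ} {σ : ℝ}

lemma measurable_smear (hT : Measurable T) :
    Measurable fun w : B × ℝ => T w.1 + σ * w.2 :=
  (hT.comp measurable_fst).add (measurable_snd.const_mul σ)

lemma isProbabilityMeasure_smearedLaw (hq : IsDensity q) (hT : Measurable T) :
    IsProbabilityMeasure (smearedLaw q T σ) := by
  have := hq.isProbabilityMeasure_law
  exact Measure.isProbabilityMeasure_map (measurable_smear hT).aemeasurable

lemma memLp_smear (hq : IsDensity q) (hT : MemLp T 2 (law q)) :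
    MemLp (fun w : B × ℝ => T w.1 + σ * w.2) 2 ((law q).prod (gaussianReal 0 1)) := by
  have := hq.isProbabilityMeasure_law
  exact (hT.comp_measurePreserving measurePreserving_fst).add
    (((memLp_id_gaussianReal 2).comp_measurePreserving measurePreserving_snd).const_mul σ)

lemma integral_sq_smear (hq : IsDensity q) (hT : MemLp T 2 (law q))
    (hT0 : ∫ y, T y ∂(law q) = 0) :
    ∫ w, (T w.1 + σ * w.2) ^ 2 ∂((law q).prod (gaussianReal 0 1))
      = ∫ y, T y ^ 2 ∂(law q) + σ ^ 2 := by
  have := hq.isProbabilityMeasure_law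
  have h1 : MemLp (fun w : B × ℝ => T w.1) 2 ((law q).prod (gaussianReal 0 1)) :=
    hT.comp_measurePreserving measurePreserving_fst
  have h2 : MemLp (fun w : B × ℝ => w.2) 2 ((law q).prod (gaussianReal 0 1)) :=
    (memLp_id_gaussianReal 2).comp_measurePreserving measurePreserving_snd
  have e : ∀ w : B × ℝ, (T w.1 + σ * w.2) ^ 2
      = T w.1 ^ 2 + (2 * σ) * (T w.1 * w.2) + σ ^ 2 * w.2 ^ 2 := fun w => by ring
  simp_rw [e]
  have i2 : Integrable (fun w : B × ℝ => T w.1 * w.2) ((law q).prod (gaussianReal 0 1)) :=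
    h1.integrable_mul h2
  have i12 : Integrable (fun w : B × ℝ => T w.1 ^ 2 + (2 * σ) * (T w.1 * w.2))
      ((law q).prod (gaussianReal 0 1)) := h1.integrable_sq.add (i2.const_mul _)
  rw [integral_add i12 (h2.integrable_sq.const_mul _),
    integral_add h1.integrable_sq (i2.const_mul _), integral_const_mul, integral_const_mul,
    integral_prod_mul (μ := law q) (ν := gaussianReal 0 1) T fun t => t, hT0,
    integral_fun_fst (μ := law q) (ν := gaussianReal 0 1) fun y => T y ^ 2,
    integral_fun_snd (μ := law q) (ν := gaussianReal 0 1) fun t => t ^ 2]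
  have hv : ∫ t, t ^ 2 ∂(gaussianReal 0 1) = 1 := by
    have := variance_of_integral_eq_zero (X := fun t : ℝ => t) (μ := gaussianReal 0 1)
      aemeasurable_id integral_id_gaussianReal
    rw [variance_fun_id_gaussianReal] at this
    simpa using this.symm
  simp [hv]

lemma charFun_smearedLaw (hq : IsDensity q) (hT : Measurable T) (t : ℝ) :
    charFun (smearedLaw q T σ) t
      = charFun ((law q).map T) t * charFun (gaussianReal 0 1) (σ * t) := by
  have := hq.isProbabilityMeasure_law
  rw [charFun_apply_real, charFun_apply_real, charFun_apply_real, smearedLaw,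
    integral_map (measurable_smear hT).aemeasurable (by fun_prop),
    integral_map hT.aemeasurable (by fun_prop), ← integral_prod_mul]
  refine integral_congr_ae (ae_of_all _ fun w => ?_)
  simp only
  rw [← Complex.exp_add]
  congr 1
  push_cast
  ring

end Smeared

section CLT

variable {A B : Space} {Φ Δ : A → B → ℝ}

/-- The sum of the Fisher informations of the coordinates. -/
def fisherSum (Φ Δ : A → B → ℝ) (n : ℕ) (x : A.power n) : ℝ :=
  ∑ i : Fin n, (fisher (Φ (x i)) (Δ (x i))).toReal

lemma charFun_scoreSum (hΦ : IsChannel Φ) (hΔ : IsTangent Φ Δ) (n : ℕ) (x : A.power n) (t : ℝ) :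
    charFun ((law (tensorPow Φ n x)).map fun y => scoreSum Φ Δ n x y / √n) t
      = ∏ i : Fin n, charFun ((law (Φ (x i))).map (score (Φ (x i)) (Δ (x i)))) ((√n)⁻¹ * t) := by
  have hexp : ∀ s : ℝ, Continuous fun u : ℝ => Complex.exp (s * u * Complex.I) := fun s => by
    fun_prop
  have := fun i => (hΦ (x i)).isProbabilityMeasure_law
  rw [charFun_apply_real, integral_map ((measurable_scoreSum hΦ hΔ x).div_const _).aemeasurable
    (hexp _).aestronglyMeasurable, law_tensorPow hΦ]
  have e : ∀ i : Fin n, charFun ((law (Φ (x i))).map (score (Φ (x i)) (Δ (x i)))) ((√n)⁻¹ * t)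
      = ∫ y, Complex.exp (((√n)⁻¹ * t : ℝ) * (score (Φ (x i)) (Δ (x i)) y : ℝ) * Complex.I)
        ∂(law (Φ (x i))) := fun i => by
    rw [charFun_apply_real, integral_map
      ((hΔ.isLocalTangent (x i)).measurable_score (hΦ (x i))).aemeasurable (hexp _).aestronglyMeasurable]
  simp_rw [e]
  refine Eq.trans ?_ (integral_fintype_prod_eq_prod (ι := Fin n) (𝕜 := ℂ)
    (μ := fun i => law (Φ (x i))) fun i y =>
      Complex.exp (((√n)⁻¹ * t : ℝ) * (score (Φ (x i)) (Δ (x i)) y : ℝ) * Complex.I))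
  refine integral_congr_ae (ae_of_all _ fun y => ?_)
  simp only
  rw [← Complex.exp_sum, scoreSum]
  congr 1
  push_cast
  rw [← Finset.sum_mul, ← Finset.mul_sum]
  ring

/-- The **central limit theorem** for the normalized sums of scores of the tensor powers of a
channel, along arbitrary inputs, with Gaussian noise that completes the variance to `J`. -/
lemma tendsto_smearedLaw_scoreSum [Finite A] (hΦ : IsChannel Φ) (hΔ : IsTangent Φ Δ) {J : ℝ}
    (hJ : ∀ x, (fisher (Φ x) (Δ x)).toReal ≤ J) (x : ∀ n, A.power n) (σ : ℕ → ℝ)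
    (hσ : ∀ n : ℕ, 0 < n →
      σ n ^ 2 = J - fisherSum Φ Δ n (x n) / n)
    (μ : ℕ → ProbabilityMeasure ℝ) (hμ : ∀ n, (μ n : Measure ℝ)
      = smearedLaw (tensorPow Φ n (x n)) (fun y => scoreSum Φ Δ n (x n) y / √n) (σ n))
    (γ : ProbabilityMeasure ℝ) (hγ : (γ : Measure ℝ) = gaussianReal 0 J.toNNReal) :
    Tendsto μ atTop (𝓝 γ) := by
  have := Fintype.ofFinite A
  have hprob := fun x => (hΦ x).isProbabilityMeasure_law
  have hmeas := fun x => (hΔ.isLocalTangent x).measurable_score (hΦ x)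
  have hprob' := fun x => Measure.isProbabilityMeasure_map (μ := law (Φ x)) (hmeas x).aemeasurable
  let J' : A → ℝ := fun x => (fisher (Φ x) (Δ x)).toReal
  have hJ'0 : ∀ x, 0 ≤ J' x := fun x => ENNReal.toReal_nonneg
  let ψ : A → ℝ → ℂ := fun x => charFun ((law (Φ x)).map (score (Φ x) (Δ x)))
  let g : A → ℝ → ℂ := fun x => charFun (gaussianReal 0 (J' x).toNNReal)
  have hψ : ∀ x, (fun t => ψ x t - g x t) =o[𝓝 0] fun t => t ^ 2 := by
    intro x
    refine charFun_sub_isLittleO ?_ (memLp_id_gaussianReal 2) ?_ ?_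
    · exact (memLp_map_measure_iff aestronglyMeasurable_id (hmeas x).aemeasurable).2
        ((hΔ.isLocalTangent x).memLp_score (hΦ x))
    · rw [integral_map (hmeas x).aemeasurable (by fun_prop), integral_id_gaussianReal]
      exact (hΔ.isLocalTangent x).integral_score (hΦ x)
    · rw [integral_map (hmeas x).aemeasurable (by fun_prop),
        (hΔ.isLocalTangent x).integral_score_sq (hΦ x)]
      have := variance_of_integral_eq_zero (X := fun t : ℝ => t)
        (μ := gaussianReal 0 (J' x).toNNReal) aemeasurable_id integral_id_gaussianReal
      rw [variance_fun_id_gaussianReal, Real.coe_toNNReal _ (hJ'0 x)] at this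
      exact this
  rw [ProbabilityMeasure.tendsto_iff_tendsto_charFun]
  intro t
  -- At the scale `t / √n` each factor differs from its Gaussian counterpart by `o(1 / n)`. Only
  -- finitely many laws occur, so one error term covers all input sequences.
  have herr : Tendsto (fun n : ℕ => (n : ℝ) * ∑ x, ‖ψ x ((√n)⁻¹ * t) - g x ((√n)⁻¹ * t)‖) atTop
      (𝓝 0) := by
    have hs : Tendsto (fun n : ℕ => (√(n : ℝ))⁻¹ * t) atTop (𝓝 0) := by
      rw [← zero_mul t]
      exact .mul_const t (tendsto_inv_atTop_zero.comp <| Real.tendsto_sqrt_atTop.comp <|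
        tendsto_natCast_atTop_atTop)
    simp_rw [Finset.mul_sum]
    rw [← Finset.sum_const_zero (s := (Finset.univ : Finset A))]
    refine tendsto_finsetSum _ fun x _ => ?_
    have ho := ((hψ x).comp_tendsto hs).norm_left
    have hO : (fun n : ℕ => (n : ℝ) * ‖ψ x ((√n)⁻¹ * t) - g x ((√n)⁻¹ * t)‖)
        =o[atTop] fun n : ℕ => (n : ℝ) * ((√(n : ℝ))⁻¹ * t) ^ 2 :=
      (Asymptotics.isBigO_refl _ _).mul_isLittleO ho
    have hb : (fun n : ℕ => (n : ℝ) * ((√(n : ℝ))⁻¹ * t) ^ 2) =O[atTop] fun _ => (1 : ℝ) := by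
      refine Asymptotics.IsBigO.of_bound (t ^ 2) ?_
      filter_upwards [eventually_gt_atTop 0] with n hn
      have hn' : (0 : ℝ) < n := by exact_mod_cast hn
      rw [mul_pow, inv_pow, Real.sq_sqrt hn'.le, ← mul_assoc, mul_inv_cancel₀ hn'.ne', one_mul]
      simp
    exact (hO.trans_isBigO hb).tendsto_div_nhds_zero.congr fun n => by simp
  let u : ∀ n, Fin n → A := fun n => x n
  refine tendsto_iff_norm_sub_tendsto_zero.2 (squeeze_zero' (Eventually.of_forall fun _ =>
    norm_nonneg _) ?_ herr)
  filter_upwards [eventually_gt_atTop 0] with n hn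
  have hn' : (0 : ℝ) < n := by exact_mod_cast hn
  -- `N(0, J)` is split into independent Gaussians of variances `J' (x i) / n` and `σ n ^ 2`, to be
  -- compared with the scores factor by factor.
  have hg : charFun (γ : Measure ℝ) t
      = (∏ i : Fin n, g (u n i) ((√n)⁻¹ * t)) * charFun (gaussianReal 0 1) (σ n * t) := by
    have hJ0 : 0 ≤ J := (hJ'0 (Classical.arbitrary A)).trans (hJ _)
    rw [hγ]
    simp only [g, charFun_gaussianReal]
    rw [← Complex.exp_sum, ← Complex.exp_add]
    congr 1
    rw [Real.coe_toNNReal _ hJ0]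
    simp_rw [Real.coe_toNNReal _ (hJ'0 _)]
    have h1 : J = (∑ i : Fin n, J' (u n i)) / n + σ n ^ 2 := by
      rw [hσ n hn]; simp only [fisherSum, J', u]; ring
    have h2 : (((√(n : ℝ))⁻¹ : ℝ) : ℂ) ^ 2 = ((n : ℝ) : ℂ)⁻¹ := by
      rw [← Complex.ofReal_pow, inv_pow, Real.sq_sqrt hn'.le, Complex.ofReal_inv]
    conv_lhs => rw [h1]
    push_cast at h2 ⊢
    simp only [mul_zero, zero_mul, zero_sub, mul_pow, h2]
    rw [Finset.sum_neg_distrib, ← Finset.sum_div, ← Finset.sum_mul]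
    simp
    ring
  rw [hμ, hg, charFun_smearedLaw (hΦ.tensorPow n (x n))
    ((measurable_scoreSum hΦ hΔ (x n)).div_const _), charFun_scoreSum hΦ hΔ, ← sub_mul, norm_mul]
  change ‖(∏ i : Fin n, ψ (u n i) ((√n)⁻¹ * t) - ∏ i : Fin n, g (u n i) ((√n)⁻¹ * t))‖ * _ ≤ _
  calc _ ≤ ‖∏ i : Fin n, ψ (u n i) ((√n)⁻¹ * t) - ∏ i : Fin n, g (u n i) ((√n)⁻¹ * t)‖ * 1 := by
        gcongr
        exact norm_charFun_le_one _
    _ ≤ ∑ i : Fin n, ‖ψ (u n i) ((√n)⁻¹ * t) - g (u n i) ((√n)⁻¹ * t)‖ := by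
        rw [mul_one]
        refine norm_prod_sub_prod_le _ _ _ (fun i _ => ?_) fun i _ => norm_charFun_le_one _
        have := hprob' (u n i)
        exact norm_charFun_le_one _
    _ ≤ ∑ _i : Fin n, ∑ x, ‖ψ x ((√n)⁻¹ * t) - g x ((√n)⁻¹ * t)‖ :=
        Finset.sum_le_sum fun i _ => Finset.single_le_sum
          (f := fun x => ‖ψ x ((√n)⁻¹ * t) - g x ((√n)⁻¹ * t)‖) (fun _ _ => norm_nonneg _)
          (Finset.mem_univ (u n i))
    _ = _ := by rw [Finset.sum_const, Finset.card_univ, Fintype.card_fin, nsmul_eq_mul]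

end CLT

/-! ### Quantization of the real line -/

/-- The real line can be cut into finitely many cells with negligible boundary, each with a centre,
such that the distance from `t` to the centre of its cell is at most `ε (1 + t ^ 2)`. -/
lemma exists_quantizer {ε : ℝ} (hε : 0 < ε) :
    ∃ (m : ℕ) (k : ℝ → Fin m) (c : Fin m → ℝ), Measurable k ∧
      (∀ j, (volume : Measure ℝ) (frontier (k ⁻¹' {j})) = 0) ∧
      (∀ j, 0 < (volume : Measure ℝ) (k ⁻¹' {j})) ∧ ∀ t, |c (k t) - t| ≤ ε * (1 + t ^ 2) := by
  obtain ⟨N', hN'⟩ := exists_nat_one_div_lt hε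
  let N : ℕ := N' + 1
  have hN1 : (1 : ℝ) ≤ N := by simp [N]
  have hN0 : (0 : ℝ) < N := by linarith
  have hNε : 1 / (N : ℝ) ≤ ε := by simpa [N] using hN'.le
  -- Cells of length `1 / N` between `-N` and `N`, the first and the last one extended to the two
  -- tails; the centre `c` is the left endpoint, or `-N` for the first cell.
  let k : ℝ → Fin (2 * N ^ 2 + 1) := fun t =>
    ⟨min (⌊t * N⌋ + (N : ℤ) ^ 2).toNat (2 * N ^ 2), by omega⟩
  let c : Fin (2 * N ^ 2 + 1) → ℝ := fun j => ((j : ℕ) - (N : ℝ) ^ 2) / N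
  have hmono : Monotone k := by
    intro s t hst
    simp only [k, Fin.mk_le_mk]
    refine min_le_min_right _ (Int.toNat_le_toNat ?_)
    gcongr
  -- Monotonicity of `k` makes the cells intervals, whose frontiers are null.
  have hord : ∀ j, (k ⁻¹' {j}).OrdConnected := fun j => by
    rw [← Set.Icc_self]
    exact Set.ordConnected_Icc.preimage_mono hmono
  refine ⟨_, k, c, hmono.measurable, fun j => ?_, fun j => ?_, fun t => ?_⟩
  · exact (hord j).convex.addHaar_frontier _
  · let a : ℝ := ((j : ℕ) - (N : ℝ) ^ 2) / N
    let b : ℝ := ((j : ℕ) + 1 - (N : ℝ) ^ 2) / N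
    have hab : a < b := by simp only [a, b]; gcongr; linarith
    have hsub : Set.Ioo a b ⊆ k ⁻¹' {j} := by
      rintro t ⟨h1, h2⟩
      have h1' := (div_lt_iff₀ hN0).1 h1
      have h2' := (lt_div_iff₀ hN0).1 h2
      have hf : ⌊t * N⌋ = (j : ℤ) - (N : ℤ) ^ 2 := by
        rw [Int.floor_eq_iff]
        push_cast
        constructor <;> linarith
      simp only [Set.mem_preimage, Set.mem_singleton_iff, k, hf, Fin.ext_iff]
      have := j.2
      omega
    refine lt_of_lt_of_le ?_ (measure_mono hsub)
    simp [hab]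
  · have hf1 := Int.floor_le (t * N)
    have hf2 := Int.lt_floor_add_one (t * N)
    have hN2 : (N : ℝ) * (1 / N) = 1 := by field_simp
    -- In the tails the error is at most `|t|`, which the quadratic term absorbs.
    have hbig : (N : ℝ) ≤ |t| → |t| ≤ 1 / N * t ^ 2 := fun h => by
      rw [← sq_abs t, one_div, inv_mul_eq_div, le_div_iff₀ hN0]
      nlinarith [abs_nonneg t]
    have hle : 1 / (N : ℝ) * (1 + t ^ 2) ≤ ε * (1 + t ^ 2) := by gcongr
    refine le_trans ?_ hle
    have hp : 0 < 1 / (N : ℝ) := by positivity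
    rcases lt_or_ge (⌊t * N⌋ + (N : ℤ) ^ 2) 0 with h | h
    · have hk : ((k t : ℕ) : ℝ) = 0 := by
        simp only [k, Int.toNat_of_nonpos h.le]; simp
      have h' : (⌊t * N⌋ : ℝ) + 1 + (N : ℝ) ^ 2 ≤ 0 := by
        have : ⌊t * N⌋ + 1 + (N : ℤ) ^ 2 ≤ 0 := by omega
        exact_mod_cast this
      have ht : t < -N := by nlinarith
      have hc : c (k t) = -N := by simp only [c, hk]; field_simp; ring
      have := hbig (by rw [abs_of_neg (by linarith)]; linarith)
      rw [abs_of_neg (by linarith)] at this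
      rw [hc, abs_of_nonneg (by linarith)]
      linarith
    · rcases le_or_gt (⌊t * N⌋ + (N : ℤ) ^ 2) (2 * (N : ℤ) ^ 2) with h2 | h2
      · have hk : ((k t : ℕ) : ℝ) = ⌊t * N⌋ + (N : ℝ) ^ 2 := by
          have : ((k t : ℕ) : ℤ) = ⌊t * N⌋ + (N : ℤ) ^ 2 := by
            have : ((N ^ 2 : ℕ) : ℤ) = (N : ℤ) ^ 2 := by push_cast; rfl
            simp only [k]; omega
          exact_mod_cast this
        have hc : c (k t) * N = ⌊t * N⌋ := by simp only [c, hk]; field_simp; ring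
        have : |c (k t) - t| ≤ 1 / N := by
          rw [abs_le]
          constructor <;> nlinarith
        nlinarith [sq_nonneg t]
      · have hk : ((k t : ℕ) : ℝ) = 2 * (N : ℝ) ^ 2 := by
          have : ((k t : ℕ) : ℤ) = 2 * (N : ℤ) ^ 2 := by
            have : ((N ^ 2 : ℕ) : ℤ) = (N : ℤ) ^ 2 := by push_cast; rfl
            simp only [k]; omega
          exact_mod_cast this
        have h' : (N : ℝ) ^ 2 < ⌊t * N⌋ := by
          have : (N : ℤ) ^ 2 < ⌊t * N⌋ := by linarith
          exact_mod_cast this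
        have ht : N < t := by nlinarith
        have hc : c (k t) = N := by simp only [c, hk]; field_simp; ring
        have := hbig (by rw [abs_of_pos (by linarith)]; linarith)
        rw [abs_of_pos (by linarith)] at this
        rw [hc, abs_of_nonpos (by linarith)]
        linarith

/-! ### Simulation of one local datum by another -/

section Simulation

variable {B B' : Space} {p δ S : B → ℝ} {q T : B' → ℝ} {σ : ℝ} {m : ℕ} {k : ℝ → Fin m}

/-- The probability that `T z + σ W` lies in the cell `j`, for a standard Gaussian `W`. -/
def cellProb (T : B' → ℝ) (σ : ℝ) (k : ℝ → Fin m) (j : Fin m) (z : B') : ℝ :=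
  (gaussianReal 0 1).real {w | k (T z + σ * w) = j}

/-- The probability of the cell `j` under the law of `T + σ W`. -/
def cellMass (q T : B' → ℝ) (σ : ℝ) (k : ℝ → Fin m) (j : Fin m) : ℝ :=
  (smearedLaw q T σ).real (k ⁻¹' {j})

/-- The density `q` reweighted by the factor `v j` on the cell `j`. -/
def reweight (q T : B' → ℝ) (σ : ℝ) (k : ℝ → Fin m) (v : Fin m → ℝ) (z : B') : ℝ :=
  q z * ∑ j, cellProb T σ k j z * v j

lemma cellProb_nonneg (j : Fin m) (z : B') : 0 ≤ cellProb T σ k j z := measureReal_nonneg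

lemma measurable_cellProb (hT : Measurable T) (hk : Measurable k) (j : Fin m) :
    Measurable (cellProb T σ k j) := by
  have hs : MeasurableSet {w : B' × ℝ | k (T w.1 + σ * w.2) = j} :=
    (hk.comp (measurable_smear hT)) (measurableSet_singleton j)
  exact (measurable_measure_prodMk_left hs).ennreal_toReal

/-- The factor in `reweight` is the conditional expectation, given `z`, of `v` at the cell of `T + σ
W`. -/
lemma sum_cellProb_mul (hk : Measurable k) (v : Fin m → ℝ) (z : B') :
    ∑ j, cellProb T σ k j z * v j = ∫ w, v (k (T z + σ * w)) ∂(gaussianReal 0 1) := by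
  have hm : Measurable fun w : ℝ => k (T z + σ * w) := hk.comp (by fun_prop)
  have e : ∀ w : ℝ, v (k (T z + σ * w))
      = ∑ j, {w | k (T z + σ * w) = j}.indicator (fun _ => v j) w := fun w => by
    simp [Set.indicator_apply]
  simp_rw [e]
  have hs : ∀ j, MeasurableSet {w | k (T z + σ * w) = j} := fun j =>
    hm (measurableSet_singleton j)
  rw [integral_finsetSum _ fun j _ => (integrable_const _).indicator (hs j)]
  refine Finset.sum_congr rfl fun j _ => ?_
  rw [integral_indicator (hs j), setIntegral_const, smul_eq_mul]
  rfl

lemma sum_cellProb (hk : Measurable k) (z : B') :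
    ∑ j, cellProb T σ k j z = 1 := by
  simpa using sum_cellProb_mul (σ := σ) hk (fun _ => 1) z

lemma integral_comp_smearedLaw (hT : Measurable T) {f : ℝ → ℝ} (hf : Measurable f) :
    ∫ t, f t ∂(smearedLaw q T σ)
      = ∫ w, f (T w.1 + σ * w.2) ∂((law q).prod (gaussianReal 0 1)) :=
  integral_map (measurable_smear hT).aemeasurable hf.aestronglyMeasurable

lemma integral_comp_quantizer {μ : Measure ℝ} [IsProbabilityMeasure μ] (hk : Measurable k)
    (v : Fin m → ℝ) : ∫ t, v (k t) ∂μ = ∑ j, μ.real (k ⁻¹' {j}) * v j := by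
  have := Measure.isProbabilityMeasure_map (μ := μ) hk.aemeasurable
  rw [← integral_map (φ := k) (f := v) hk.aemeasurable
    (measurable_of_finite v).aestronglyMeasurable, integral_fintype .of_finite]
  refine Finset.sum_congr rfl fun j _ => ?_
  rw [map_measureReal_apply hk (measurableSet_singleton j), smul_eq_mul]

lemma measurable_reweight (hq : IsDensity q) (hT : Measurable T) (hk : Measurable k)
    (v : Fin m → ℝ) : Measurable (reweight q T σ k v) :=
  hq.measurable.mul (Finset.measurable_fun_sum _ fun j _ =>
    (measurable_cellProb hT hk j).mul_const _)

lemma measurable_comp_quantizer (hk : Measurable k) (v : Fin m → ℝ) : Measurable fun t => v (k t) :=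
  (measurable_of_finite v).comp hk

lemma integrable_comp_quantizer {Ω : Type*} [MeasurableSpace Ω] {μ : Measure Ω} [IsFiniteMeasure μ]
    {g : Ω → Fin m} (hg : Measurable g) (v : Fin m → ℝ) : Integrable (fun t => v (g t)) μ := by
  refine Integrable.of_bound ((measurable_of_finite v).comp hg).aestronglyMeasurable
    (∑ j, |v j|) (ae_of_all _ fun t => ?_)
  exact Finset.single_le_sum (f := fun j => |v j|) (fun _ _ => abs_nonneg _) (Finset.mem_univ _)

lemma integrable_reweight (hq : IsDensity q) (hT : Measurable T) (hk : Measurable k)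
    (v : Fin m → ℝ) : Integrable (reweight q T σ k v) := by
  have := hq.isProbabilityMeasure_law
  refine (hq.integrable_law_iff _).1 ?_
  simp_rw [sum_cellProb_mul hk]
  have h : Integrable (fun w : B' × ℝ => v (k (T w.1 + σ * w.2)))
      ((law q).prod (gaussianReal 0 1)) :=
    integrable_comp_quantizer (hk.comp (measurable_smear hT)) v
  exact h.integral_prod_left

lemma integral_reweight (hq : IsDensity q) (hT : Measurable T) (hk : Measurable k)
    (v : Fin m → ℝ) : ∫ z, reweight q T σ k v z = ∑ j, cellMass q T σ k j * v j := by
  have := hq.isProbabilityMeasure_law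
  have := isProbabilityMeasure_smearedLaw (σ := σ) hq hT
  simp only [reweight]
  rw [← hq.integral_law]
  simp_rw [sum_cellProb_mul hk]
  have h : Integrable (fun w : B' × ℝ => v (k (T w.1 + σ * w.2)))
      ((law q).prod (gaussianReal 0 1)) :=
    integrable_comp_quantizer (hk.comp (measurable_smear hT)) v
  rw [← integral_prod _ h, ← integral_comp_smearedLaw (f := fun t => v (k t)) hT
    (measurable_comp_quantizer hk v), integral_comp_quantizer hk]
  rfl

/-- The distance from a reweighted density to the density. -/
lemma lintegral_reweight_sub_le (hq : IsDensity q) (hT : Measurable T) (hk : Measurable k)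
    (v : Fin m → ℝ) :
    ∫⁻ z, ‖reweight q T σ k v z - q z‖ₑ
      ≤ ENNReal.ofReal (∑ j, cellMass q T σ k j * |v j - 1|) := by
  rw [← integral_reweight hq hT hk, ofReal_integral_eq_lintegral_ofReal
    (integrable_reweight hq hT hk _) (ae_of_all _ fun z => mul_nonneg (hq.nonneg z)
      (Finset.sum_nonneg fun j _ => mul_nonneg (cellProb_nonneg j z) (abs_nonneg _)))]
  refine lintegral_mono fun z => ?_
  rw [← ofReal_norm]
  refine ENNReal.ofReal_le_ofReal ?_
  have e : reweight q T σ k v z - q z = q z * ∑ j, cellProb T σ k j z * (v j - 1) := by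
    simp only [reweight, mul_sub, mul_one, Finset.sum_sub_distrib, sum_cellProb hk]
  rw [e, norm_mul, Real.norm_of_nonneg (hq.nonneg z)]
  refine mul_le_mul_of_nonneg_left ((norm_sum_le _ _).trans (Finset.sum_le_sum fun j _ => ?_))
    (hq.nonneg z)
  rw [norm_mul, Real.norm_of_nonneg (cellProb_nonneg j z), Real.norm_eq_abs]

/-- The distance from a reweighted density to the signed density with score `T`. -/
lemma lintegral_reweight_sub_mul_le (hq : IsDensity q) (hT : Measurable T)
    (hT2 : MemLp T 2 (law q)) (hk : Measurable k) (v : Fin m → ℝ) :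
    ∫⁻ z, ‖reweight q T σ k v z - q z * T z‖ₑ
      ≤ ENNReal.ofReal (∫ t, |v (k t) - t| ∂(smearedLaw q T σ)) := by
  have := hq.isProbabilityMeasure_law
  rw [integral_comp_smearedLaw (f := fun t => |v (k t) - t|) hT
    ((measurable_comp_quantizer hk v).sub measurable_id).norm]
  have h1 : Integrable (fun w : B' × ℝ => v (k (T w.1 + σ * w.2)))
      ((law q).prod (gaussianReal 0 1)) :=
    integrable_comp_quantizer (hk.comp (measurable_smear hT)) v
  have h2 : Integrable (fun w : B' × ℝ => v (k (T w.1 + σ * w.2)) - (T w.1 + σ * w.2))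
      ((law q).prod (gaussianReal 0 1)) := h1.sub ((memLp_smear hq hT2).integrable one_le_two)
  have hint : Integrable (fun z => ∫ w, |v (k (T z + σ * w)) - (T z + σ * w)| ∂(gaussianReal 0 1))
      (law q) := h2.abs.integral_prod_left
  rw [integral_prod _ h2.abs, hq.integral_law, ofReal_integral_eq_lintegral_ofReal
    ((hq.integrable_law_iff _).1 hint) (ae_of_all _ fun z => mul_nonneg (hq.nonneg z)
      (integral_nonneg fun _ => abs_nonneg _))]
  refine lintegral_mono fun z => ?_
  rw [← ofReal_norm]
  refine ENNReal.ofReal_le_ofReal ?_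
  have i1 : Integrable (fun w : ℝ => v (k (T z + σ * w))) (gaussianReal 0 1) :=
    integrable_comp_quantizer (hk.comp (by fun_prop)) v
  have i3 : Integrable (fun w : ℝ => σ * w) (gaussianReal 0 1) :=
    ((memLp_id_gaussianReal 1).integrable le_rfl).const_mul σ
  have i2 : Integrable (fun w : ℝ => T z + σ * w) (gaussianReal 0 1) :=
    (integrable_const _).add i3
  -- The noise is centred, so the conditional expectation of `T + σ W` given `z` is `T z`; this is
  -- why added noise does not disturb the tangent vector.
  have e : ∫ w, (T z + σ * w) ∂(gaussianReal 0 1) = T z := by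
    rw [integral_add (integrable_const _) i3, integral_const_mul, integral_id_gaussianReal]
    simp
  rw [reweight, sum_cellProb_mul hk, ← mul_sub, norm_mul, Real.norm_of_nonneg (hq.nonneg z)]
  refine mul_le_mul_of_nonneg_left ?_ (hq.nonneg z)
  have e' : ∫ w, v (k (T z + σ * w)) ∂(gaussianReal 0 1) - T z
      = ∫ w, (v (k (T z + σ * w)) - (T z + σ * w)) ∂(gaussianReal 0 1) := by
    rw [integral_sub i1 i2, e]
  rw [e']
  exact norm_integral_le_integral_norm _

/-- The integral of `f` over the set where `S` lies in the cell `j`. -/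
def cellIntegral (S : B → ℝ) (k : ℝ → Fin m) (f : B → ℝ) (j : Fin m) : ℝ :=
  ∫ y, if k (S y) = j then f y else 0

/-- The transition density of the Markov map which replaces `y` by a point drawn from `q`
conditioned on `T + σ W` lying in the cell of `S y`. -/
def transitionDensity (S : B → ℝ) (q T : B' → ℝ) (σ : ℝ) (k : ℝ → Fin m) (y : B) : B' → ℝ :=
  reweight q T σ k fun j => if k (S y) = j then (cellMass q T σ k j)⁻¹ else 0

/-- The image of `f` under the Markov map with transition density `transitionDensity S q T σ k`. -/
def simulate (S : B → ℝ) (q T : B' → ℝ) (σ : ℝ) (k : ℝ → Fin m) (f : B → ℝ) : B' → ℝ :=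
  reweight q T σ k fun j => cellIntegral S k f j / cellMass q T σ k j

lemma integrable_cell {f : B → ℝ} (hS : Measurable S) (hk : Measurable k) (hf : Integrable f)
    (j : Fin m) : Integrable fun y => if k (S y) = j then f y else 0 := by
  have hs : MeasurableSet {y | k (S y) = j} := (hk.comp hS) (measurableSet_singleton j)
  exact (hf.indicator hs).congr (ae_of_all _ fun y => by simp [Set.indicator_apply])

lemma sum_cellIntegral {f : B → ℝ} (hS : Measurable S) (hk : Measurable k) (hf : Integrable f) :
    ∑ j, cellIntegral S k f j = ∫ y, f y := by
  simp only [cellIntegral]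
  rw [← integral_finsetSum _ fun j _ => integrable_cell hS hk hf j]
  simp

lemma simulate_apply {f : B → ℝ} (hS : Measurable S) (hk : Measurable k) (hf : Integrable f)
    (z : B') : simulate S q T σ k f z = ∫ y, transitionDensity S q T σ k y z * f y := by
  have e : ∀ y, transitionDensity S q T σ k y z * f y
      = ∑ j, (q z * (cellProb T σ k j z * (cellMass q T σ k j)⁻¹))
          * if k (S y) = j then f y else 0 := fun y => by
    rw [transitionDensity, reweight, Finset.mul_sum, Finset.sum_mul]
    refine Finset.sum_congr rfl fun j _ => ?_
    split_ifs <;> ring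
  simp_rw [e]
  rw [integral_finsetSum _ fun j _ => (integrable_cell hS hk hf j).const_mul _]
  rw [simulate, reweight, Finset.mul_sum]
  refine Finset.sum_congr rfl fun j _ => ?_
  rw [integral_const_mul, ← cellIntegral]
  ring

lemma isDensity_transitionDensity (hq : IsDensity q) (hT : Measurable T) (hk : Measurable k)
    (hQ : ∀ j, 0 < cellMass q T σ k j) (y : B) : IsDensity (transitionDensity S q T σ k y) := by
  refine .of_integral (measurable_reweight hq hT hk _) (fun z => ?_)
    (integrable_reweight hq hT hk _) ?_
  · refine mul_nonneg (hq.nonneg z) (Finset.sum_nonneg fun j _ => mul_nonneg (cellProb_nonneg j z) ?_)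
    have := hQ j
    dsimp only
    split_ifs <;> positivity
  · simp only [transitionDensity]
    rw [integral_reweight hq hT hk]
    simp [(hQ _).ne']

lemma measurable_transitionDensity (hS : Measurable S) (hq : IsDensity q) (hT : Measurable T)
    (hk : Measurable k) : Measurable (Function.uncurry (transitionDensity S q T σ k)) := by
  refine (hq.measurable.comp measurable_snd).mul (Finset.measurable_fun_sum _ fun j _ =>
    ((measurable_cellProb hT hk j).comp measurable_snd).mul ?_)
  exact Measurable.ite (((hk.comp hS).comp measurable_fst) (measurableSet_singleton j))
    measurable_const measurable_const

lemma isDensity_simulate (hp : IsDensity p) (hS : Measurable S) (hq : IsDensity q)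
    (hT : Measurable T) (hk : Measurable k) (hQ : ∀ j, 0 < cellMass q T σ k j) :
    IsDensity (simulate S q T σ k p) := by
  refine .of_integral (measurable_reweight hq hT hk _) (fun z => ?_)
    (integrable_reweight hq hT hk _) ?_
  · refine mul_nonneg (hq.nonneg z) (Finset.sum_nonneg fun j _ => mul_nonneg (cellProb_nonneg j z) ?_)
    refine div_nonneg (integral_nonneg fun y => ?_) (hQ j).le
    have := hp.nonneg y
    dsimp only [Pi.zero_apply]
    split_ifs <;> simp [this]
  · simp only [simulate]
    rw [integral_reweight hq hT hk]
    simp_rw [mul_div_cancel₀ _ (hQ _).ne']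
    rw [sum_cellIntegral hS hk hp.integrable, hp.integral_eq_one]

/-- There are finitely many cells and each has positive `p`-mass, so the cell masses of `δ` are at
most a constant times those of `p`. The simulated score is then bounded, and the total mass zero is
preserved. -/
lemma isLocalTangent_simulate (hp : IsDensity p) (hδ : IsLocalTangent p δ) (hS : Measurable S)
    (hq : IsDensity q) (hT : Measurable T) (hk : Measurable k)
    (hQ : ∀ j, 0 < cellMass q T σ k j) (hP : ∀ j, 0 < cellIntegral S k p j) :
    IsLocalTangent (simulate S q T σ k p) (simulate S q T σ k δ) := by
  have hd := isDensity_simulate hp hS hq hT hk hQ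
  have hm : Measurable (simulate S q T σ k δ) := measurable_reweight hq hT hk _
  have := hd.isProbabilityMeasure_law
  let M : ℝ := ∑ j, |cellIntegral S k δ j| / cellIntegral S k p j
  have hM : ∀ j, |cellIntegral S k δ j| ≤ M * cellIntegral S k p j := fun j => by
    rw [← div_le_iff₀ (hP j)]
    exact Finset.single_le_sum (f := fun j => |cellIntegral S k δ j| / cellIntegral S k p j)
      (fun j _ => div_nonneg (abs_nonneg _) (hP j).le) (Finset.mem_univ j)
  have hM0 : 0 ≤ M := Finset.sum_nonneg fun j _ => div_nonneg (abs_nonneg _) (hP j).le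
  have hbound : ∀ z, |simulate S q T σ k δ z| ≤ M * simulate S q T σ k p z := fun z => by
    simp only [simulate, reweight]
    rw [abs_mul, abs_of_nonneg (hq.nonneg z), mul_left_comm]
    refine mul_le_mul_of_nonneg_left ((Finset.abs_sum_le_sum_abs _ _).trans ?_) (hq.nonneg z)
    rw [Finset.mul_sum]
    refine Finset.sum_le_sum fun j _ => ?_
    rw [abs_mul, abs_div, abs_of_nonneg (cellProb_nonneg j z), abs_of_pos (hQ j), mul_left_comm]
    refine mul_le_mul_of_nonneg_left ?_ (cellProb_nonneg j z)
    rw [← mul_div_assoc]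
    exact div_le_div_of_nonneg_right (hM j) (hQ j).le
  let L : B' → ℝ := score (simulate S q T σ k p) (simulate S q T σ k δ)
  have hLm : Measurable L := hm.div hd.measurable
  have he : ∀ z, simulate S q T σ k δ z = simulate S q T σ k p z * L z := fun z => by
    rcases eq_or_ne (simulate S q T σ k p z) 0 with h | h
    · have := hbound z
      rw [h, mul_zero] at this
      rw [h, zero_mul]
      exact abs_nonpos_iff.1 this
    · simp only [L, score]
      rw [mul_div_cancel₀ _ h]
  have hL : MemLp L 2 (law (simulate S q T σ k p)) := by
    refine MemLp.of_bound hLm.aestronglyMeasurable M (ae_of_all _ fun z => ?_)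
    simp only [L, score, norm_div, Real.norm_eq_abs, abs_of_nonneg (hd.nonneg z)]
    exact div_le_of_le_mul₀ (hd.nonneg z) hM0 (hbound z)
  refine (isLocalTangent_of_ae_eq hd hm hLm hL ?_ (ae_of_all _ he)).1
  rw [hd.integral_law]
  simp_rw [← he]
  simp only [simulate]
  rw [integral_reweight hq hT hk]
  simp_rw [mul_div_cancel₀ _ (hQ _).ne']
  rw [sum_cellIntegral hS hk hδ.integrable, hδ.integral_eq_zero]

end Simulation

/-! ### Asymptotically exact simulation of tensor powers -/

section SimulationError

variable {B B' : Space} {p δ S : B → ℝ} {q T : B' → ℝ} {σ : ℝ} {m : ℕ} {k : ℝ → Fin m}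

lemma cellIntegral_eq_integral_law (hp : IsDensity p) (f : B → ℝ) (j : Fin m) :
    cellIntegral S k (fun y => p y * f y) j = ∫ y, (if k (S y) = j then f y else 0) ∂(law p) := by
  rw [hp.integral_law, cellIntegral]
  simp only [mul_ite, mul_zero]

lemma cellIntegral_eq_map (hp : IsDensity p) (hS : Measurable S) (hk : Measurable k) (j : Fin m) :
    cellIntegral S k p j = ((law p).map S).real (k ⁻¹' {j}) := by
  have h := cellIntegral_eq_integral_law (S := S) (k := k) hp (fun _ => 1) j
  simp only [mul_one] at h
  have hs : MeasurableSet (S ⁻¹' (k ⁻¹' {j})) := hS (hk (measurableSet_singleton j))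
  rw [h, map_measureReal_apply hS (hk (measurableSet_singleton j)), ← integral_indicator_one hs]
  refine integral_congr_ae (ae_of_all _ fun y => ?_)
  by_cases hy : k (S y) = j
  · exact (if_pos hy).trans (Set.indicator_of_mem (s := S ⁻¹' (k ⁻¹' {j})) hy (1 : B → ℝ)).symm
  · exact (if_neg hy).trans (Set.indicator_of_notMem (s := S ⁻¹' (k ⁻¹' {j})) hy (1 : B → ℝ)).symm

/-- Lets the estimate on the cells of the smeared law be applied, with zero noise, to the source of
a simulation. -/
lemma cellIntegral_eq_cellMass (hp : IsDensity p) (hS : Measurable S) (hk : Measurable k)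
    (j : Fin m) : cellIntegral S k p j = cellMass p S 0 k j := by
  have := hp.isProbabilityMeasure_law
  have e : (fun w : B × ℝ => S w.1 + 0 * w.2) = S ∘ Prod.fst := funext fun w => by simp
  rw [cellIntegral_eq_map hp hS hk, cellMass, smearedLaw, e, ← Measure.map_map hS measurable_fst,
    Measure.map_fst_prod]
  simp

/-- The distance from the simulated density to the target density. -/
lemma lintegral_simulate_sub_le (hq : IsDensity q) (hT : Measurable T) (hk : Measurable k)
    (hQ : ∀ j, 0 < cellMass q T σ k j) :
    ∫⁻ z, ‖simulate S q T σ k p z - q z‖ₑ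
      ≤ ENNReal.ofReal (∑ j, |cellIntegral S k p j - cellMass q T σ k j|) := by
  refine (lintegral_reweight_sub_le hq hT hk _).trans_eq ?_
  congr 1
  refine Finset.sum_congr rfl fun j _ => ?_
  rw [← abs_of_pos (hQ j), ← abs_mul, abs_of_pos (hQ j), mul_sub, mul_div_cancel₀ _ (hQ j).ne',
    mul_one]

/-- On the cell `j` the statistic `S` differs from `c j` by at most `ε (1 + S²)`, and the cells are
disjoint, so the errors add up to an expectation. -/
lemma sum_abs_cellIntegral_sub_le (hp : IsDensity p) (hS : Measurable S) (hS2 : MemLp S 2 (law p))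
    (hk : Measurable k) {J ε : ℝ} (hε : 0 ≤ ε) (hSJ : ∫ y, S y ^ 2 ∂(law p) ≤ J)
    {c : Fin m → ℝ} (hc : ∀ t, |c (k t) - t| ≤ ε * (1 + t ^ 2)) :
    ∑ j, |cellIntegral S k (fun y => p y * S y) j - c j * cellIntegral S k p j|
      ≤ ε * (1 + J) := by
  have := hp.isProbabilityMeasure_law
  have hSi := hS2.integrable one_le_two
  have hcell : ∀ j (f : B → ℝ), Integrable f (law p) →
      Integrable (fun y => if k (S y) = j then f y else 0) (law p) := fun j f hf => by
    have hs : MeasurableSet {y | k (S y) = j} := (hk.comp hS) (measurableSet_singleton j)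
    exact (hf.indicator hs).congr (ae_of_all _ fun y => by simp [Set.indicator_apply])
  have hP : ∀ j, c j * cellIntegral S k p j
      = ∫ y, (if k (S y) = j then c j else 0) ∂(law p) := fun j => by
    have h := cellIntegral_eq_integral_law (S := S) (k := k) hp (fun _ => 1) j
    simp only [mul_one] at h
    rw [h, ← integral_const_mul]
    simp only [mul_ite, mul_one, mul_zero]
  have hj : ∀ j, |cellIntegral S k (fun y => p y * S y) j - c j * cellIntegral S k p j|
      ≤ ∫ y, (if k (S y) = j then |c j - S y| else 0) ∂(law p) := fun j => by
    have e : cellIntegral S k (fun y => p y * S y) j - c j * cellIntegral S k p j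
        = ∫ y, ((if k (S y) = j then S y else 0) - if k (S y) = j then c j else 0) ∂(law p) := by
      rw [hP, cellIntegral_eq_integral_law hp S j]
      exact (integral_sub (hcell j S hSi) (hcell j (fun _ => c j) (integrable_const _))).symm
    rw [e]
    refine abs_integral_le_integral_abs.trans_eq (integral_congr_ae (ae_of_all _ fun y => ?_))
    dsimp only
    split_ifs
    · exact abs_sub_comm _ _
    · rw [sub_zero, abs_zero]
  have e : ∑ j, ∫ y, (if k (S y) = j then |c j - S y| else 0) ∂(law p)
      = ∫ y, |c (k (S y)) - S y| ∂(law p) := by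
    rw [← integral_finsetSum _ fun j _ => hcell j (fun y => |c j - S y|)
      ((integrable_const _).sub hSi).abs]
    simp only [Finset.sum_ite_eq, Finset.mem_univ, if_true]
  refine (Finset.sum_le_sum fun j _ => hj j).trans (e.trans_le ?_)
  have hi : Integrable (fun y => 1 + S y ^ 2) (law p) := (integrable_const _).add hS2.integrable_sq
  calc ∫ y, |c (k (S y)) - S y| ∂(law p) ≤ ∫ y, ε * (1 + S y ^ 2) ∂(law p) :=
        integral_mono_of_nonneg (ae_of_all _ fun _ => abs_nonneg _) (hi.const_mul ε)
          (ae_of_all _ fun y => hc (S y))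
    _ = ε * (1 + ∫ y, S y ^ 2 ∂(law p)) := by
        rw [integral_const_mul, integral_add (integrable_const _) hS2.integrable_sq]
        simp
    _ ≤ _ := by gcongr

/-- The distance from the simulated tangent vector to the target tangent vector. -/
lemma lintegral_simulate_tangent_sub_le (hp : IsDensity p) (hS : Measurable S)
    (hS2 : MemLp S 2 (law p)) (hq : IsDensity q) (hT : Measurable T) (hT2 : MemLp T 2 (law q))
    (hT0 : ∫ z, T z ∂(law q) = 0) (hk : Measurable k) (hQ : ∀ j, 0 < cellMass q T σ k j)
    {β J ε : ℝ} (hβ : 0 ≤ β) (hε : 0 ≤ ε) (hδ : ∀ᵐ y, δ y = β * (p y * S y))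
    (hSJ : ∫ y, S y ^ 2 ∂(law p) ≤ J) (hTJ : ∫ z, T z ^ 2 ∂(law q) + σ ^ 2 ≤ J)
    {c : Fin m → ℝ} (hc : ∀ t, |c (k t) - t| ≤ ε * (1 + t ^ 2)) :
    ∫⁻ z, ‖simulate S q T σ k δ z - β * (q z * T z)‖ₑ
      ≤ ENNReal.ofReal (β * (∑ j, |c j| * |cellIntegral S k p j - cellMass q T σ k j|
          + 2 * ε * (1 + J))) := by
  have := hp.isProbabilityMeasure_law
  have := hq.isProbabilityMeasure_law
  have := isProbabilityMeasure_smearedLaw (σ := σ) hq hT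
  let D : Fin m → ℝ := cellIntegral S k fun y => p y * S y
  -- The conditional mean of the source score, up to the ratio of the two cell masses; it should be
  -- close to the centre `c j`.
  let v : Fin m → ℝ := fun j => D j / cellMass q T σ k j
  have hD : ∀ j, cellIntegral S k δ j = β * D j := fun j => by
    simp only [D, cellIntegral]
    rw [← integral_const_mul]
    refine integral_congr_ae (hδ.mono fun y hy => ?_)
    simp only [hy, mul_ite, mul_zero]
  have e : ∀ z, simulate S q T σ k δ z - β * (q z * T z)
      = β * (reweight q T σ k v z - q z * T z) := fun z => by
    rw [mul_sub]
    congr 1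
    simp only [simulate, reweight, hD, v]
    rw [Finset.mul_sum, Finset.mul_sum, Finset.mul_sum]
    exact Finset.sum_congr rfl fun j _ => by ring
  simp_rw [e, enorm_mul]
  rw [lintegral_const_mul' _ _ enorm_ne_top, Real.enorm_of_nonneg hβ, ENNReal.ofReal_mul hβ]
  refine mul_le_mul_right ((lintegral_reweight_sub_mul_le hq hT hT2 hk v).trans
    (ENNReal.ofReal_le_ofReal ?_)) _
  have hsq : Integrable (fun t : ℝ => t ^ 2) (smearedLaw q T σ) :=
    (integrable_map_measure (by fun_prop) (measurable_smear hT).aemeasurable).2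
      (memLp_smear hq hT2).integrable_sq
  have hsqJ : ∫ t, t ^ 2 ∂(smearedLaw q T σ) ≤ J := by
    rw [integral_comp_smearedLaw hT (by fun_prop), integral_sq_smear hq hT2 hT0]
    exact hTJ
  have hsq1 : Integrable (fun t : ℝ => 1 + t ^ 2) (smearedLaw q T σ) := (integrable_const _).add hsq
  have hdom : Integrable (fun t => |v (k t) - c (k t)| + ε * (1 + t ^ 2)) (smearedLaw q T σ) :=
    (integrable_comp_quantizer hk fun j => |v j - c j|).add
      (hsq1.const_mul ε)
  -- Comparison passes through the centres. Quantization costs `ε (1 + J)` on the target side here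
  -- and again on the source side in `h2`; the differing cell masses enter in `h3`.
  have h1 : ∫ t, |v (k t) - t| ∂(smearedLaw q T σ)
      ≤ ∑ j, |D j - c j * cellMass q T σ k j| + ε * (1 + J) := by
    calc ∫ t, |v (k t) - t| ∂(smearedLaw q T σ)
        ≤ ∫ t, (|v (k t) - c (k t)| + ε * (1 + t ^ 2)) ∂(smearedLaw q T σ) :=
          integral_mono_of_nonneg (ae_of_all _ fun _ => abs_nonneg _) hdom
            (ae_of_all _ fun t => (abs_sub_le _ (c (k t)) _).trans (add_le_add_right (hc t) _))
      _ = ∑ j, cellMass q T σ k j * |v j - c j|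
            + ε * (1 + ∫ t, t ^ 2 ∂(smearedLaw q T σ)) := by
          rw [integral_add (integrable_comp_quantizer hk fun j => |v j - c j|)
            (hsq1.const_mul ε),
            integral_comp_quantizer hk fun j => |v j - c j|, integral_const_mul,
            integral_add (integrable_const _) hsq]
          simp [cellMass]
      _ ≤ _ := by
          refine add_le_add (Finset.sum_le_sum fun j _ => le_of_eq ?_) (by gcongr)
          rw [← abs_of_pos (hQ j), ← abs_mul, abs_of_pos (hQ j), mul_sub,
            mul_div_cancel₀ _ (hQ j).ne', mul_comm (c j)]
  have h2 : ∑ j, |D j - c j * cellIntegral S k p j| ≤ ε * (1 + J) :=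
    sum_abs_cellIntegral_sub_le hp hS hS2 hk hε hSJ hc
  have h3 : ∑ j, |D j - c j * cellMass q T σ k j| ≤ ∑ j, |D j - c j * cellIntegral S k p j|
      + ∑ j, |c j| * |cellIntegral S k p j - cellMass q T σ k j| := by
    rw [← Finset.sum_add_distrib]
    refine Finset.sum_le_sum fun j _ => ?_
    rw [← abs_mul, mul_sub]
    exact abs_sub_le _ _ _
  linarith

end SimulationError

section Asymptotic

variable {A B : Space} {Φ Δ : A → B → ℝ}

/-- The noise that completes the variance of the normalized score to `J`. -/
def completingNoise (Φ Δ : A → B → ℝ) (J : ℝ) (n : ℕ) (x : A.power n) : ℝ :=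
  √(J - fisherSum Φ Δ n x / n)

/-- The normalized score. -/
def normScore (Φ Δ : A → B → ℝ) (n : ℕ) (x : A.power n) (y : B.power n) : ℝ :=
  scoreSum Φ Δ n x y / √n

lemma measurable_normScore (hΦ : IsChannel Φ) (hΔ : IsTangent Φ Δ) {n : ℕ} (x : A.power n) :
    Measurable (normScore Φ Δ n x) := (measurable_scoreSum hΦ hΔ x).div_const _

lemma memLp_normScore (hΦ : IsChannel Φ) (hΔ : IsTangent Φ Δ) {n : ℕ} (x : A.power n) :
    MemLp (normScore Φ Δ n x) 2 (law (tensorPow Φ n x)) := by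
  have := (memLp_scoreSum hΦ hΔ x).mul_const (√(n : ℝ))⁻¹
  simpa only [normScore, div_eq_mul_inv] using! this

lemma integral_normScore (hΦ : IsChannel Φ) (hΔ : IsTangent Φ Δ) {n : ℕ} (x : A.power n) :
    ∫ y, normScore Φ Δ n x y ∂(law (tensorPow Φ n x)) = 0 := by
  simp only [normScore]
  rw [integral_div, integral_scoreSum hΦ hΔ, zero_div]

lemma integral_normScore_sq (hΦ : IsChannel Φ) (hΔ : IsTangent Φ Δ) {n : ℕ} (x : A.power n) :
    ∫ y, normScore Φ Δ n x y ^ 2 ∂(law (tensorPow Φ n x)) = fisherSum Φ Δ n x / n := by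
  simp only [normScore, div_pow, Real.sq_sqrt (Nat.cast_nonneg n)]
  rw [integral_div, integral_scoreSum_sq hΦ hΔ]
  rfl

lemma tangentPow_ae_eq_normScore (hΦ : IsChannel Φ) (hΔ : IsTangent Φ Δ) {n : ℕ} (hn : 0 < n)
    (x : A.power n) :
    ∀ᵐ y, tangentPow Φ Δ n x y = √n * (tensorPow Φ n x y * normScore Φ Δ n x y) := by
  have h : √(n : ℝ) ≠ 0 := (Real.sqrt_pos.2 (by exact_mod_cast hn)).ne'
  filter_upwards [tangentPow_ae_eq hΦ hΔ x] with y hy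
  rw [hy, normScore]
  field_simp

lemma fisherSum_div_le {J : ℝ} (hJ : ∀ x, (fisher (Φ x) (Δ x)).toReal ≤ J) {n : ℕ} (hn : 0 < n)
    (x : A.power n) : fisherSum Φ Δ n x / n ≤ J := by
  have hn' : (0 : ℝ) < n := by exact_mod_cast hn
  rw [div_le_iff₀ hn', fisherSum]
  refine (Finset.sum_le_sum fun (i : Fin n) _ => hJ (x i)).trans_eq ?_
  rw [Finset.sum_const, Finset.card_univ, Fintype.card_fin, nsmul_eq_mul, mul_comm]

lemma sq_completingNoise {J : ℝ} (hJ : ∀ x, (fisher (Φ x) (Δ x)).toReal ≤ J) {n : ℕ} (hn : 0 < n)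
    (x : A.power n) : completingNoise Φ Δ J n x ^ 2 = J - fisherSum Φ Δ n x / n :=
  Real.sq_sqrt (sub_nonneg.2 (fisherSum_div_le hJ hn x))

/-- The central limit theorem on the cells of a quantizer, uniformly in the input. -/
lemma eventually_cellMass [Finite A] (hΦ : IsChannel Φ) (hΔ : IsTangent Φ Δ) {J : ℝ} (hJ0 : 0 < J)
    (hJ : ∀ x, (fisher (Φ x) (Δ x)).toReal ≤ J) {m : ℕ} {k : ℝ → Fin m}
    (hfr : ∀ j, (volume : Measure ℝ) (frontier (k ⁻¹' {j})) = 0) {η : ℝ} (hη : 0 < η) :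
    ∀ᶠ n : ℕ in atTop, ∀ (x : A.power n) (j : Fin m),
      |cellMass (tensorPow Φ n x) (normScore Φ Δ n x) (completingNoise Φ Δ J n x) k j
        - (gaussianReal 0 J.toNNReal).real (k ⁻¹' {j})| ≤ η := by
  classical
  let good : ∀ n : ℕ, A.power n → Prop := fun n x => ∀ j : Fin m,
      |cellMass (tensorPow Φ n x) (normScore Φ Δ n x) (completingNoise Φ Δ J n x) k j
        - (gaussianReal 0 J.toNNReal).real (k ⁻¹' {j})| ≤ η
  -- A bad input is chosen whenever there is one; convergence along this one sequence gives
  -- uniformity over all inputs.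
  let x : ∀ n, A.power n := fun n =>
    if h : ∃ x, ¬ good n x then h.choose else Classical.arbitrary _
  suffices h : ∀ᶠ n in atTop, good n (x n) by
    filter_upwards [h] with n hn
    by_contra hcon
    have hex : ∃ x, ¬ good n x := by
      by_contra h'
      push Not at h'
      exact hcon h'
    simp only [x, dif_pos hex] at hn
    exact hex.choose_spec hn
  have hprob := fun n => isProbabilityMeasure_smearedLaw (σ := completingNoise Φ Δ J n (x n))
    (hΦ.tensorPow n (x n)) (measurable_normScore hΦ hΔ (x n))
  let μ : ℕ → ProbabilityMeasure ℝ := fun n => ⟨_, hprob n⟩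
  let γ : ProbabilityMeasure ℝ := ⟨gaussianReal 0 J.toNNReal, inferInstance⟩
  have hlim : Tendsto μ atTop (𝓝 γ) :=
    tendsto_smearedLaw_scoreSum hΦ hΔ hJ x (fun n => completingNoise Φ Δ J n (x n))
      (fun n hn => sq_completingNoise hJ hn (x n)) μ (fun n => rfl) γ rfl
  have hJne : J.toNNReal ≠ 0 := by simpa using hJ0
  refine eventually_all.2 fun j => ?_
  -- `N(0, J)` is absolutely continuous as `J > 0`, so the frontiers of the cells are null for the
  -- limit law.
  have h := ProbabilityMeasure.tendsto_measure_of_null_frontier_of_tendsto' hlim (E := k ⁻¹' {j})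
    (gaussianReal_absolutelyContinuous 0 hJne (hfr j))
  have h' := (ENNReal.tendsto_toReal (measure_ne_top (γ : Measure ℝ) _)).comp h
  filter_upwards [(Metric.tendsto_nhds.1 h') η hη] with n hn
  exact (Real.dist_eq _ _ ▸ hn).le

/-- Every local datum whose score is asymptotically Gaussian with variance `J` can be transformed,
up to a small error, to the tensor powers of a channel with Fisher information at most `J`. -/
lemma exists_simulation [Finite A] (hΦ : IsChannel Φ) (hΔ : IsTangent Φ Δ) {J : ℝ} (hJ0 : 0 < J)
    (hJ : ∀ x, (fisher (Φ x) (Δ x)).toReal ≤ J) {ε : ℝ} (hε : 0 < ε) :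
    ∃ (m : ℕ) (k : ℝ → Fin m) (η : ℝ), Measurable k ∧
      (∀ j, (volume : Measure ℝ) (frontier (k ⁻¹' {j})) = 0) ∧ 0 < η ∧
      ∀ᶠ n : ℕ in atTop, ∀ x : A.power n,
        (∀ j, 0 < cellMass (tensorPow Φ n x) (normScore Φ Δ n x) (completingNoise Φ Δ J n x) k j) ∧
        ∀ (B₀ : Space) (p δ S : B₀ → ℝ), IsDensity p → IsLocalTangent p δ → Measurable S →
          (∀ᵐ y, δ y = √n * (p y * S y)) →
          (∀ j, |cellIntegral S k p j - (gaussianReal 0 J.toNNReal).real (k ⁻¹' {j})| ≤ η) →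
          MemLp S 2 (law p) → ∫ y, S y ^ 2 ∂(law p) ≤ J →
          IsDensity (simulate S (tensorPow Φ n x) (normScore Φ Δ n x)
            (completingNoise Φ Δ J n x) k p) ∧
          IsLocalTangent (simulate S (tensorPow Φ n x) (normScore Φ Δ n x)
            (completingNoise Φ Δ J n x) k p) (simulate S (tensorPow Φ n x) (normScore Φ Δ n x)
            (completingNoise Φ Δ J n x) k δ) ∧
          ∫⁻ y, ‖simulate S (tensorPow Φ n x) (normScore Φ Δ n x)
            (completingNoise Φ Δ J n x) k p y - tensorPow Φ n x y‖ₑ ≤ ENNReal.ofReal ε ∧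
          ∫⁻ y, ‖simulate S (tensorPow Φ n x) (normScore Φ Δ n x)
            (completingNoise Φ Δ J n x) k δ y - tangentPow Φ Δ n x y‖ₑ
              ≤ ENNReal.ofReal (ε * √n) := by
  -- With this accuracy the quantization error `2 ε' (1 + J)` of the tangent vector is `ε / 2`.
  have hε0 : 0 < ε / (4 * (1 + J)) := by positivity
  obtain ⟨m, k, c, hk, hfr, hpos, hc⟩ := exists_quantizer hε0
  have hJne : J.toNNReal ≠ 0 := by simpa using hJ0
  let Γ : Fin m → ℝ := fun j => (gaussianReal 0 J.toNNReal).real (k ⁻¹' {j})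
  have hΓ : ∀ j, 0 < Γ j := fun j => by
    refine ENNReal.toReal_pos (fun h => ?_) (measure_ne_top _ _)
    exact (hpos j).ne' (gaussianReal_absolutelyContinuous' 0 hJne h)
  have : Nonempty (Fin m) := ⟨k 0⟩
  obtain ⟨j₀, hj₀⟩ := Finite.exists_min Γ
  let C : ℝ := ∑ j, |c j|
  have hC0 : 0 ≤ C := Finset.sum_nonneg fun _ _ => abs_nonneg _
  have hD0 : (0 : ℝ) < 4 * (C + m + 1) := by positivity
  -- The first bound keeps all cell masses positive. The second makes the errors `2 m η` and `2 C η`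
  -- from the cell masses at most `ε / 2`.
  let η : ℝ := min (Γ j₀ / 2) (ε / (4 * (C + m + 1)))
  have hη : 0 < η := lt_min (half_pos (hΓ j₀)) (by positivity)
  have hηΓ : ∀ j, η < Γ j := fun j => by
    have := min_le_left (Γ j₀ / 2) (ε / (4 * (C + m + 1)))
    have := hj₀ j
    have := hΓ j₀
    simp only [η]
    linarith
  have hηε : 4 * (C + m + 1) * η ≤ ε := by
    rw [mul_comm, ← le_div_iff₀ hD0]
    exact min_le_right _ _
  refine ⟨m, k, η, hk, hfr, hη, ?_⟩
  filter_upwards [eventually_cellMass hΦ hΔ hJ0 hJ hfr hη, eventually_gt_atTop 0] with n hn hn0 x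
  have hQ : ∀ j, 0 < cellMass (tensorPow Φ n x) (normScore Φ Δ n x)
      (completingNoise Φ Δ J n x) k j := fun j => by
    have := (abs_le.1 (hn x j)).1
    have h2 := hηΓ j
    simp only [Γ] at h2
    linarith
  refine ⟨hQ, fun B₀ p δ S hp hδ hS he hP hS2 hSJ => ?_⟩
  have hT := measurable_normScore hΦ hΔ x
  have hq := hΦ.tensorPow n x
  have hP0 : ∀ j, 0 < cellIntegral S k p j := fun j => by
    have := (abs_le.1 (hP j)).1
    have h2 := hηΓ j
    simp only [Γ] at h2
    linarith
  have hPQ : ∀ j, |cellIntegral S k p j - cellMass (tensorPow Φ n x) (normScore Φ Δ n x)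
      (completingNoise Φ Δ J n x) k j| ≤ 2 * η := fun j => by
    have h1 := hP j
    have h2 := hn x j
    rw [abs_sub_comm] at h2
    exact (abs_sub_le _ _ _).trans ((add_le_add h1 h2).trans_eq (by ring))
  refine ⟨isDensity_simulate hp hS hq hT hk hQ,
    isLocalTangent_simulate hp hδ hS hq hT hk hQ hP0, ?_, ?_⟩
  · refine (lintegral_simulate_sub_le hq hT hk hQ).trans (ENNReal.ofReal_le_ofReal ?_)
    refine (Finset.sum_le_sum fun j _ => hPQ j).trans ?_
    rw [Finset.sum_const, Finset.card_univ, Fintype.card_fin, nsmul_eq_mul]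
    nlinarith [mul_nonneg hC0 hη.le, mul_nonneg (Nat.cast_nonneg (α := ℝ) m) hη.le]
  · have h := lintegral_simulate_tangent_sub_le hp hS hS2 hq hT (memLp_normScore hΦ hΔ x)
      (integral_normScore hΦ hΔ x) hk hQ (Real.sqrt_nonneg n) hε0.le he hSJ
      (J := J) (by rw [integral_normScore_sq hΦ hΔ, sq_completingNoise hJ hn0]; linarith) hc
    have e : ∫⁻ y, ‖simulate S (tensorPow Φ n x) (normScore Φ Δ n x)
            (completingNoise Φ Δ J n x) k δ y - tangentPow Φ Δ n x y‖ₑ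
        = ∫⁻ y, ‖simulate S (tensorPow Φ n x) (normScore Φ Δ n x)
            (completingNoise Φ Δ J n x) k δ y
              - √n * (tensorPow Φ n x y * normScore Φ Δ n x y)‖ₑ :=
      lintegral_congr_ae ((tangentPow_ae_eq_normScore hΦ hΔ hn0 x).mono fun y hy => by
        simp only [hy])
    rw [e]
    refine h.trans (ENNReal.ofReal_le_ofReal ?_)
    rw [mul_comm ε]
    refine mul_le_mul_of_nonneg_left ?_ (Real.sqrt_nonneg n)
    have h1 : ∑ j, |c j| * |cellIntegral S k p j - cellMass (tensorPow Φ n x) (normScore Φ Δ n x)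
        (completingNoise Φ Δ J n x) k j| ≤ C * (2 * η) := by
      rw [Finset.sum_mul]
      exact Finset.sum_le_sum fun j _ => mul_le_mul_of_nonneg_left (hPQ j) (abs_nonneg _)
    have h2 : 2 * (ε / (4 * (1 + J))) * (1 + J) = ε / 2 := by field_simp; norm_num
    rw [h2]
    nlinarith [mul_nonneg (Nat.cast_nonneg (α := ℝ) m) hη.le]

end Asymptotic

/-! ### The Gaussian shift -/

section Gaussian

lemma isDensity_gaussian : IsDensity (B := .real) (gaussianPDFReal 0 1) := by
  refine ⟨measurable_gaussianPDFReal 0 1, gaussianPDFReal_nonneg 0 1, ?_⟩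
  exact lintegral_gaussianPDFReal_eq_one 0 one_ne_zero

lemma law_gaussian : law (B := .real) (gaussianPDFReal 0 1) = gaussianReal 0 1 := by
  rw [gaussianReal_of_var_ne_zero 0 one_ne_zero]
  rfl

/-- The standard Gaussian distribution as a channel. -/
def gaussianChannel : Space.finite 0 → Space.real → ℝ := fun _ (y : ℝ) => gaussianPDFReal 0 1 y

/-- The shift of the standard Gaussian distribution with speed `a`. -/
def gaussianShift (a : ℝ) : Space.finite 0 → Space.real → ℝ :=
  a • fun _ (y : ℝ) => y * gaussianPDFReal 0 1 y

lemma isChannel_gaussian : IsChannel gaussianChannel := fun _ => isDensity_gaussian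

lemma gaussianShift_apply (a : ℝ) (u : Space.finite 0) (y : ℝ) :
    gaussianShift a u y = gaussianPDFReal 0 1 y * (a * y) := by
  change a * (y * gaussianPDFReal 0 1 y) = _
  ring

lemma memLp_const_mul_gaussian (a : ℝ) : MemLp (fun y : ℝ => a * y) 2 (gaussianReal 0 1) :=
  (memLp_id_gaussianReal 2).const_mul a

lemma integral_sq_gaussian (a : ℝ) : ∫ y, (a * y) ^ 2 ∂(gaussianReal 0 1) = a ^ 2 := by
  have := variance_of_integral_eq_zero (X := fun t : ℝ => t) (μ := gaussianReal 0 1)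
    aemeasurable_id integral_id_gaussianReal
  rw [variance_fun_id_gaussianReal] at this
  simp_rw [mul_pow]
  rw [integral_const_mul, ← this]
  simp

lemma isLocalTangent_gaussianShift (a : ℝ) (u : Space.finite 0) :
    IsLocalTangent (gaussianChannel u) (gaussianShift a u) ∧
      (fisher (gaussianChannel u) (gaussianShift a u)).toReal = a ^ 2 := by
  have hm : Measurable fun y : ℝ => a * y := by fun_prop
  have h := isLocalTangent_of_ae_eq (B := .real) (p := gaussianPDFReal 0 1)
    (δ := gaussianShift a u) (L := fun y : ℝ => a * y) isDensity_gaussian ?_ hm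
    (by rw [law_gaussian]; exact memLp_const_mul_gaussian a) ?_
    (ae_of_all _ (gaussianShift_apply a u))
  · refine ⟨h.1, ?_⟩
    change (fisher (B := .real) (gaussianPDFReal 0 1) _).toReal = _
    rw [h.2, law_gaussian, ← integral_sq_gaussian a]
    exact (integral_eq_lintegral_of_nonneg_ae (ae_of_all _ fun _ => sq_nonneg _)
      (by fun_prop)).symm
  · exact (measurable_id.mul (measurable_gaussianPDFReal 0 1)).const_mul a
  · rw [law_gaussian]
    refine (integral_const_mul a fun y : ℝ => y).trans ?_
    exact (congrArg (a * ·) integral_id_gaussianReal).trans (mul_zero a)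

lemma isTangent_gaussianShift (a : ℝ) : IsTangent gaussianChannel (gaussianShift a) :=
  isTangent_of_isLocalTangent isChannel_gaussian fun u => (isLocalTangent_gaussianShift a u).1

lemma metric_gaussianShift {G : ChannelFunctional} (hG : IsChannelMetric G) (hN : AxiomN0 G)
    (a : ℝ) : G (.finite 0) .real gaussianChannel (gaussianShift a) = a ^ 2 := by
  have h1 : IsTangent gaussianChannel fun _ (y : ℝ) => y * gaussianPDFReal 0 1 y := by
    have := isTangent_gaussianShift 1
    rwa [gaussianShift, one_smul] at this
  have := hG.smul _ _ gaussianChannel _ a isChannel_gaussian h1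
  rw [gaussianShift]
  refine this.trans ?_
  rw [show G (.finite 0) .real gaussianChannel _ = 1 from hN (.finite 0), mul_one]

end Gaussian

/-! ### The lower bound -/

section Lower

instance (n : ℕ) : Subsingleton ((Space.finite 0).power n) :=
  inferInstanceAs (Subsingleton (Fin n → Fin 1))

/-- A metric that satisfies the axioms is at least the Fisher information on distributions. -/
lemma fisher_le_metric {G : ChannelFunctional} (hG : IsChannelMetric G) (hM2 : AxiomM2 G)
    (hA : AxiomA G) (hC : AxiomC G) (hN : AxiomN0 G) {B : Space} {p δ : B → ℝ}
    (hp : IsDensity p) (hδ : IsLocalTangent p δ) :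
    (fisher p δ).toReal ≤ G (.finite 0) B (fun _ => p) (fun _ => δ) := by
  let Φ : Space.finite 0 → B → ℝ := fun _ => p
  let Δ : Space.finite 0 → B → ℝ := fun _ => δ
  have hΦ : IsChannel Φ := fun _ => hp
  have hΔ : IsTangent Φ Δ := isTangent_of_isLocalTangent hΦ fun _ => hδ
  set J : ℝ := (fisher p δ).toReal with hJdef
  rcases (ENNReal.toReal_nonneg : 0 ≤ (fisher p δ).toReal).eq_or_lt' with hJ0 | hJ0
  · rw [hJdef, hJ0]
    exact hG.nonneg _ _ _ _ hΦ hΔ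
  change 0 < J at hJ0
  have hsq : √J ^ 2 = J := Real.sq_sqrt hJ0.le
  have hgJ : ∀ u, (fisher (gaussianChannel u) (gaussianShift √J u)).toReal ≤ J := fun u => by
    rw [(isLocalTangent_gaussianShift √J u).2, hsq]
  have hsum : ∀ n : ℕ, 0 < n → ∀ x, fisherSum Φ Δ n x / n = J := fun n hn x => by
    have hn' : (n : ℝ) ≠ 0 := by exact_mod_cast hn.ne'
    have e : fisherSum Φ Δ n x = ∑ _i : Fin n, J := rfl
    rw [e, Finset.sum_const, Finset.card_univ, Fintype.card_fin, nsmul_eq_mul]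
    exact mul_div_cancel_left₀ _ hn'
  -- The Gaussian shift of speed `√J` becomes the target of the approximation, and `{p, δ}` the
  -- source.
  rw [← hsq, ← metric_gaussianShift hG hN]
  refine le_of_forall_pos_le_add fun θ hθ => ?_
  refine le_of_asymptotic_approx hA hC isChannel_gaussian (isTangent_gaussianShift _)
    fun ε hε => ?_
  obtain ⟨m, k, η, hk, hfr, hη, hsim⟩ :=
    exists_simulation isChannel_gaussian (isTangent_gaussianShift √J) hJ0 hgJ hε
  have hlim := hA _ _ Φ Δ hΦ hΔ
  filter_upwards [hsim, eventually_cellMass hΦ hΔ hJ0 (fun _ => le_rfl) hfr hη,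
    hlim.eventually (eventually_le_nhds (lt_add_of_pos_right _ hθ)), eventually_gt_atTop 0]
    with n hn hcell hlimn hn0
  let x₀ : (Space.finite 0).power n := Classical.arbitrary _
  -- The source already has variance exactly `J`, so its central limit theorem holds without noise.
  have hσ : completingNoise Φ Δ J n x₀ = 0 := by
    rw [completingNoise, hsum n hn0, sub_self, Real.sqrt_zero]
  have hS := measurable_normScore hΦ hΔ x₀
  have hpn := hΦ.tensorPow n x₀
  obtain ⟨hQ, hrest⟩ := hn x₀
  obtain ⟨h1, h2, h3, h4⟩ := hrest (B.power n) (tensorPow Φ n x₀) (tangentPow Φ Δ n x₀)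
    (normScore Φ Δ n x₀) hpn (isLocalTangent_tangentPow hΦ hΔ x₀) hS
    (tangentPow_ae_eq_normScore hΦ hΔ hn0 x₀)
    (fun j => by
      have h := hcell x₀ j
      rwa [hσ, ← cellIntegral_eq_cellMass hpn hS hk] at h)
    (memLp_normScore hΦ hΔ x₀) (by rw [integral_normScore_sq hΦ hΔ, hsum n hn0])
  have hq := isChannel_gaussian.tensorPow n x₀
  have hT := measurable_normScore isChannel_gaussian (isTangent_gaussianShift √J) x₀
  refine ⟨fun _ => _, fun _ => _, fun _ => h1, isTangent_of_isLocalTangent (fun _ => h1) fun _ => h2,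
    fun x => by rwa [Subsingleton.elim x x₀], fun x => by rwa [Subsingleton.elim x x₀], ?_⟩
  refine le_trans (mul_le_mul_of_nonneg_left ?_ (by positivity)) hlimn
  have hkm := measurable_transitionDensity (σ := completingNoise gaussianChannel (gaussianShift √J)
    J n x₀) hS hq hT hk
  have hkd : ∀ y, IsDensity (transitionDensity (normScore Φ Δ n x₀) _ _ _ k y) :=
    isDensity_transitionDensity hq hT hk hQ
  refine hM2 _ _ _ _ _ _ _ (densityKernel _) (hΦ.tensorPow n) (hΔ.tangentPow hΦ n)
    (fun _ => h1) (isTangent_of_isLocalTangent (fun _ => h1) fun _ => h2)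
    -- The approximation is an image of `{p^{⊗ n}, δ^{(n)}}` under a Markov map, so (M2) bounds it
    -- by the metric there, which `hlimn` controls through (A).
    (isMarkovMap_densityKernel hkm hkd) (fun x => ?_) fun x => ?_
  · rw [Subsingleton.elim x x₀]
    exact isImage_densityKernel hkm hkd hpn.integrable
      (simulate_apply hS hk hpn.integrable)
  · rw [Subsingleton.elim x x₀]
    have hi := (isLocalTangent_tangentPow hΦ hΔ x₀).integrable
    exact isImage_densityKernel hkm hkd hi (simulate_apply hS hk hi)

/-- The channel that maps every input to the input `f w`. -/
def deterministic {A A' : Space} (f : A' → A) : A' → A → ℝ :=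
  open Classical in fun w x => if x = f w then 1 else 0

variable {A A' B : Space}

lemma isChannel_deterministic [Finite A] (f : A' → A) : IsChannel (deterministic f) := by
  have := Fintype.ofFinite A
  intro w
  refine ⟨measurable_of_finite _, fun x => ?_, ?_⟩
  · simp only [deterministic]; split_ifs <;> norm_num
  · rw [Space.lintegral_eq_sum]
    rw [Finset.sum_eq_single_of_mem (f w) (Finset.mem_univ _) fun x _ hx => by
      simp [deterministic, hx]]
    simp [deterministic]

lemma precomp_deterministic [Finite A] (Λ : A → B → ℝ) (f : A' → A) :
    precomp Λ (deterministic f) = fun w => Λ (f w) := by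
  have := Fintype.ofFinite A
  ext w y
  rw [precomp, Space.integral_eq_sum,
    Finset.sum_eq_single_of_mem (f w) (Finset.mem_univ _) fun x _ hx => by
      simp [deterministic, hx]]
  simp [deterministic]

lemma fisher_le_channelMetric {G : ChannelFunctional} (hG : IsChannelMetric G) (hM1 : AxiomM1 G)
    (hM2 : AxiomM2 G) (hA : AxiomA G) (hC : AxiomC G) (hN : AxiomN0 G) [Finite A]
    {Φ Δ : A → B → ℝ} (hΦ : IsChannel Φ) (hΔ : IsTangent Φ Δ) (x : A) :
    (fisher (Φ x) (Δ x)).toReal ≤ G A B Φ Δ := by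
  refine (fisher_le_metric hG hM2 hA hC hN (hΦ x) (hΔ.isLocalTangent x)).trans ?_
  have := hM1 (.finite 0) A B Φ Δ (deterministic fun _ => x) hΦ hΔ (isChannel_deterministic _)
  rwa [precomp_deterministic, precomp_deterministic] at this

end Lower

/-! ### Channels tensored with an identity channel -/

section TensorId

variable {A B C : Space}

/-- The embedding of a sample space as a fibre of its product with a finite sample space. -/
def fibre (w : C) (z : B) : B.prod C := (z, w)

lemma measurableEmbedding_fibre (w : C) : MeasurableEmbedding (fibre (B := B) w) :=
  measurableEmbedding_prod_mk_right w

/-- Points of the finite space `C` have mass one, so each slice carries the reference measure of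
`B`. -/
lemma map_fibre [Finite C] (w : C) : (volume : Measure B).map (fibre w)
    = (volume : Measure (B.prod C)).restrict (Set.range (fibre w)) := by
  have h1 : (volume : Measure B).prod (Measure.dirac w) = (volume : Measure B).map (fibre w) :=
    Measure.prod_dirac w
  have h2 := Measure.prod_restrict (μ := (volume : Measure B)) (ν := (volume : Measure C))
    Set.univ {w}
  have hr : (Set.range (fibre w) : Set (B × C)) = Set.univ ×ˢ {w} := by
    ext y
    constructor
    · rintro ⟨z, rfl⟩; exact ⟨trivial, rfl⟩
    · rintro ⟨-, h⟩; exact ⟨y.1, Prod.ext rfl (Set.mem_singleton_iff.1 h).symm⟩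
  rw [Measure.restrict_univ, Measure.restrict_singleton, Space.volume_singleton, one_smul, h1,
    ← hr] at h2
  exact h2

open Classical in
/-- The extension of `F` by zero outside the fibre over `w`. -/
def onFibre {M : Type} [Zero M] (w : C) (F : B.prod C → M) (y : B.prod C) : M :=
  if w = y.2 then F y else 0

lemma onFibre_eq_indicator {M : Type} [Zero M] (w : C) (F : B.prod C → M) :
    onFibre w F = (Set.range (fibre w)).indicator F := by
  classical
  ext y
  rw [onFibre, Set.indicator_apply]
  congr 1
  refine propext ⟨fun h => ⟨y.1, Prod.ext rfl h⟩, ?_⟩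
  rintro ⟨z, rfl⟩
  rfl

lemma integral_onFibre [Finite C] (w : C) (F : B.prod C → ℝ) :
    ∫ y, onFibre w F y = ∫ z, F (fibre w z) := by
  rw [onFibre_eq_indicator, integral_indicator (measurableEmbedding_fibre w).measurableSet_range,
    ← map_fibre, (measurableEmbedding_fibre w).integral_map]

lemma lintegral_onFibre [Finite C] (w : C) (F : B.prod C → ℝ≥0∞) :
    ∫⁻ y, onFibre w F y = ∫⁻ z, F (fibre w z) := by
  rw [onFibre_eq_indicator, lintegral_indicator (measurableEmbedding_fibre w).measurableSet_range,
    ← map_fibre, (measurableEmbedding_fibre w).lintegral_map]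

lemma integrable_onFibre [Finite C] (w : C) {F : B.prod C → ℝ}
    (h : Integrable fun z => F (fibre w z)) : Integrable (onFibre w F) := by
  rw [onFibre_eq_indicator,
    integrable_indicator_iff (measurableEmbedding_fibre w).measurableSet_range, IntegrableOn,
    ← map_fibre, (measurableEmbedding_fibre w).integrable_map_iff]
  exact h

lemma measurable_onFibre {M : Type} [Zero M] [MeasurableSpace M] (w : C) {F : B.prod C → M}
    (h : Measurable F) : Measurable (onFibre w F) := by
  rw [onFibre_eq_indicator]
  exact h.indicator (measurableEmbedding_fibre w).measurableSet_range

lemma tensorId_apply (Λ : A → B → ℝ) (x : A) (w : C) :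
    tensorId C Λ (x, w) = onFibre w fun y => Λ x y.1 := by
  ext y
  simp [tensorId, onFibre]

lemma onFibre_comp {M N : Type} [Zero M] [Zero N] (w : C) (F : B.prod C → M) {g : M → N}
    (hg : g 0 = 0) (y : B.prod C) : g (onFibre w F y) = onFibre w (fun y => g (F y)) y := by
  simp only [onFibre]
  split_ifs
  · rfl
  · exact hg

lemma isDensity_onFibre [Finite C] (w : C) {p : B → ℝ} (hp : IsDensity p) :
    IsDensity (onFibre (C := C) w fun y => p y.1) := by
  refine ⟨measurable_onFibre w (hp.measurable.comp measurable_fst), fun y => ?_, ?_⟩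
  · simp only [onFibre]
    split_ifs
    exacts [hp.nonneg _, le_rfl]
  · simp_rw [onFibre_comp w (fun y : B.prod C => p y.1) ENNReal.ofReal_zero]
    rw [lintegral_onFibre]
    exact hp.lintegral_eq_one

lemma isLocalTangent_onFibre [Finite C] (w : C) {p δ : B → ℝ} (hδ : IsLocalTangent p δ) :
    IsLocalTangent (onFibre (C := C) w fun y => p y.1) (onFibre w fun y => δ y.1) := by
  refine ⟨measurable_onFibre w (hδ.measurable.comp measurable_fst),
    integrable_onFibre w hδ.integrable, ?_, ?_⟩
  · rw [integral_onFibre]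
    exact hδ.integral_eq_zero
  · have e : ∀ y : B.prod C, ENNReal.ofReal (onFibre w (fun y => δ y.1) y ^ 2)
        / ENNReal.ofReal (onFibre w (fun y => p y.1) y)
        = onFibre w (fun y => ENNReal.ofReal (δ y.1 ^ 2) / ENNReal.ofReal (p y.1)) y := fun y => by
      simp only [onFibre]
      split_ifs
      · rfl
      -- Off the fibre both densities vanish, and `0 / 0 = 0`.
      · simp
    rw [fisher]
    simp_rw [e]
    rw [lintegral_onFibre]
    exact hδ.fisher_lt_top

lemma isChannel_tensorId [Finite C] {Φ : A → B → ℝ} (hΦ : IsChannel Φ) :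
    IsChannel (tensorId C Φ) := by
  rintro ⟨x, w⟩
  rw [tensorId_apply]
  exact isDensity_onFibre w (hΦ x)

lemma isTangent_tensorId [Finite A] [Finite C] {Φ Δ : A → B → ℝ} (hΦ : IsChannel Φ)
    (hΔ : IsTangent Φ Δ) : IsTangent (tensorId C Φ) (tensorId C Δ) := by
  refine isTangent_of_isLocalTangent (isChannel_tensorId hΦ) ?_
  rintro ⟨x, w⟩
  rw [tensorId_apply, tensorId_apply]
  exact isLocalTangent_onFibre w (hΔ.isLocalTangent x)

end TensorId

/-! ### The upper bound -/

section Upper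

variable {A B : Space} {Φ Δ : A → B → ℝ}

lemma ae_eq_zero_of_fisher_eq_zero {p δ : B → ℝ} (hp : IsDensity p) (hδ : IsLocalTangent p δ)
    (h : fisher p δ = 0) : δ =ᵐ[volume] 0 := by
  have hm : Measurable fun y => ENNReal.ofReal (δ y ^ 2) / ENNReal.ofReal (p y) :=
    ((hδ.measurable.pow_const 2).ennreal_ofReal).div hp.measurable.ennreal_ofReal
  filter_upwards [(lintegral_eq_zero_iff hm).1 h] with y hy
  simp only [Pi.zero_apply, ENNReal.div_eq_zero_iff, ENNReal.ofReal_ne_top, or_false,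
    ENNReal.ofReal_eq_zero] at hy
  exact pow_eq_zero_iff two_ne_zero |>.1 (le_antisymm hy (sq_nonneg _))

lemma map_const_mul_gaussian {J : ℝ} (hJ : 0 ≤ J) :
    (gaussianReal 0 1).map (fun y => √J * y) = gaussianReal 0 J.toNNReal := by
  rw [gaussianReal_map_const_mul]
  congr 1
  · simp
  · ext
    simp [Real.sq_sqrt hJ, hJ]

/-- A metric that satisfies the axioms is at most the largest Fisher information. -/
lemma metric_le_of_fisher_le {G : ChannelFunctional} (hG : IsChannelMetric G) (hM1 : AxiomM1 G)
    (hM2 : AxiomM2 G) (hE : AxiomE G) (hA : AxiomA G) (hC : AxiomC G) (hN : AxiomN0 G) [Finite A]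
    (hΦ : IsChannel Φ) (hΔ : IsTangent Φ Δ) {J : ℝ} (hJ0 : 0 < J)
    (hJ : ∀ x, (fisher (Φ x) (Δ x)).toReal ≤ J) : G A B Φ Δ ≤ J := by
  refine le_of_asymptotic_approx hA hC hΦ hΔ fun ε hε => ?_
  obtain ⟨m, k, η, hk, hfr, hη, hsim⟩ := exists_simulation hΦ hΔ hJ0 hJ hε
  filter_upwards [hsim, eventually_gt_atTop 0] with n hn hn0
  have hn' : (0 : ℝ) < n := by exact_mod_cast hn0
  -- The identity channel on `C` hands the input sequence over to the Markov map as its program.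
  let C : Space := A.power n
  have hCfin : Finite C := inferInstanceAs (Finite (A.power n))
  -- With this speed the Gaussian tangent vector is `√n p S` for `S y = √J y`, the normalization of
  -- `Δ^{(n)}`; the law of `S` is exactly `N(0, J)`, so the source has no cell error.
  let a : ℝ := √n * √J
  let p : Space.real → ℝ := gaussianChannel default
  let δ : Space.real → ℝ := gaussianShift a default
  let S : Space.real → ℝ := fun y : ℝ => √J * y
  have hp : IsDensity p := isChannel_gaussian default
  have hδ : IsLocalTangent p δ := (isLocalTangent_gaussianShift a default).1
  have hlaw : law p = gaussianReal 0 1 := law_gaussian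
  have hS : Measurable S := measurable_id.const_mul √J
  have hδS : ∀ᵐ y, δ y = √n * (p y * S y) := ae_of_all _ fun y => by
    refine (gaussianShift_apply a default y).trans ?_
    exact (by intros; ring : ∀ s t u v : ℝ, s * (t * u * v) = t * (s * (u * v))) _ _ _ _
  have hcell : ∀ j, |cellIntegral S k p j - (gaussianReal 0 J.toNNReal).real (k ⁻¹' {j})| ≤ η :=
    fun j => by
      rw [cellIntegral_eq_map hp hS hk, hlaw]
      refine le_trans (le_of_eq ?_) hη.le
      rw [abs_eq_zero, sub_eq_zero]
      exact congrArg (fun μ : Measure ℝ => μ.real (k ⁻¹' {j})) (map_const_mul_gaussian hJ0.le)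
  have hS2 : MemLp S 2 (law p) := by
    rw [hlaw]
    exact memLp_const_mul_gaussian √J
  have hSJ : ∫ y, S y ^ 2 ∂(law p) ≤ J := by
    rw [hlaw]
    exact ((integral_sq_gaussian √J).trans (Real.sq_sqrt hJ0.le)).le
  let τ : C → Space.real → B.power n → ℝ := fun w => transitionDensity S (tensorPow Φ n w)
    (normScore Φ Δ n w) (completingNoise Φ Δ J n w) k
  let sim : (Space.real → ℝ) → C → B.power n → ℝ := fun f w => simulate S (tensorPow Φ n w)
    (normScore Φ Δ n w) (completingNoise Φ Δ J n w) k f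
  have hsim := fun w : C => (hn w).2 .real p δ S hp hδ hS hδS hcell hS2 hSJ
  have hΨ : IsChannel (sim p) := fun w => (hsim w).1
  have hΘ : IsTangent (sim p) (sim δ) := isTangent_of_isLocalTangent hΨ fun w => (hsim w).2.1
  refine ⟨sim p, sim δ, hΨ, hΘ, fun w => (hsim w).2.2.1, fun w => (hsim w).2.2.2, ?_⟩
  -- The map reads the program `w = y.2` and runs the simulation of the output for the input `w` on
  -- the Gaussian sample `y.1`.
  let K : Space.real.prod C → B.power n → ℝ := fun y => τ y.2 y.1
  have hKm : Measurable (Function.uncurry K) := by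
    have h : ∀ w, Measurable (Function.uncurry (τ w)) := fun w =>
      measurable_transitionDensity hS (hΦ.tensorPow n w) (measurable_normScore hΦ hΔ w) hk
    have h' : Measurable fun u : C × (Space.real × B.power n) => Function.uncurry (τ u.1) u.2 :=
      measurable_from_prod_countable_right h
    exact h'.comp ((measurable_snd.comp measurable_fst).prodMk
      ((measurable_fst.comp measurable_fst).prodMk measurable_snd))
  have hKd : ∀ y, IsDensity (K y) := fun y => isDensity_transitionDensity (hΦ.tensorPow n y.2)
    (measurable_normScore hΦ hΔ y.2) hk (hn y.2).1 y.1
  have himg : ∀ (f : Space.real → ℝ), Integrable f → ∀ w : C,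
      IsImage (densityKernel K) (onFibre w fun y => f y.1) (sim f w) := fun f hf w =>
    isImage_densityKernel hKm hKd (integrable_onFibre w hf) fun z => by
      refine (simulate_apply hS hk hf z).trans ?_
      refine (integral_onFibre w fun y => K y z * f y.1).symm.trans
        (integral_congr_ae (ae_of_all _ fun y => ?_))
      simp only [onFibre]
      split_ifs
      · rfl
      · exact (mul_zero _).symm
  -- Preparation before the Gaussian channel, which has a single input; `w` enters the identity
  -- channel.
  let f : C → (Space.finite 0).prod C := fun w => (default, w)
  have hΦI := isChannel_tensorId (C := C) isChannel_gaussian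
  have hΔI := isTangent_tensorId (C := C) isChannel_gaussian (isTangent_gaussianShift a)
  have hval : G _ _ (tensorId C gaussianChannel) (tensorId C (gaussianShift a)) = n * J := by
    rw [hE _ _ C _ _ isChannel_gaussian (isTangent_gaussianShift a), metric_gaussianShift hG hN,
      mul_pow, Real.sq_sqrt hn'.le, Real.sq_sqrt hJ0.le]
  have h1 := hM1 C _ _ _ _ (deterministic f) hΦI hΔI (isChannel_deterministic f)
  rw [precomp_deterministic, precomp_deterministic, hval] at h1
  have hch : IsChannel fun w => tensorId C gaussianChannel (f w) := fun w => hΦI (f w)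
  have hta : IsTangent (fun w => tensorId C gaussianChannel (f w))
      fun w => tensorId C (gaussianShift a) (f w) :=
    isTangent_of_isLocalTangent hch fun w => hΔI.isLocalTangent (f w)
  have h2 := hM2 C _ _ _ _ _ _ (densityKernel K) hch hta hΨ hΘ (isMarkovMap_densityKernel hKm hKd)
    (fun w => by rw [tensorId_apply]; exact himg p hp.integrable w)
    (fun w => by rw [tensorId_apply]; exact himg δ hδ.integrable w)
  calc 1 / (n : ℝ) * G C (B.power n) (sim p) (sim δ) ≤ 1 / (n : ℝ) * (n * J) :=
        mul_le_mul_of_nonneg_left (h2.trans h1) (by positivity)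
    _ = J := by field_simp

end Upper

/-! ### The minimal metric -/

section Gmin

variable {A B : Space} {Φ Δ : A → B → ℝ}

lemma exists_fisher_eq_Gmin [Finite A] (hΔ : IsTangent Φ Δ) :
    ∃ x₀, Gmin A B Φ Δ = (fisher (Φ x₀) (Δ x₀)).toReal ∧
      ∀ x, (fisher (Φ x) (Δ x)).toReal ≤ (fisher (Φ x₀) (Δ x₀)).toReal := by
  obtain ⟨x₀, h⟩ := Finite.exists_max fun x => fisher (Φ x) (Δ x)
  refine ⟨x₀, ?_, fun x => ENNReal.toReal_mono (hΔ.2 x₀).ne (h x)⟩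
  rw [Gmin]
  congr 1
  exact le_antisymm (iSup_le h) (le_iSup (fun x => fisher (Φ x) (Δ x)) x₀)

lemma fisher_le_Gmin [Finite A] (hΔ : IsTangent Φ Δ) (x : A) :
    (fisher (Φ x) (Δ x)).toReal ≤ Gmin A B Φ Δ := by
  obtain ⟨x₀, e, h⟩ := exists_fisher_eq_Gmin hΔ
  exact e ▸ h x

/-- Additivity of the Fisher information at the maximizing input sequence. -/
lemma Gmin_tangentPow_le [Finite A] (hΦ : IsChannel Φ) (hΔ : IsTangent Φ Δ) {J : ℝ}
    (hJ : ∀ x, (fisher (Φ x) (Δ x)).toReal ≤ J) {n : ℕ} (hn : 0 < n) :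
    1 / (n : ℝ) * Gmin (A.power n) (B.power n) (tensorPow Φ n) (tangentPow Φ Δ n) ≤ J := by
  obtain ⟨x, e, -⟩ := exists_fisher_eq_Gmin (hΔ.tangentPow hΦ n)
  rw [e, fisher_tangentPow hΦ hΔ, one_div, inv_mul_eq_div]
  exact fisherSum_div_le hJ hn x

/-- Truncation to the interval `[-M, M]`. -/
def clamp (M t : ℝ) : ℝ := max (-M) (min t M)

lemma continuous_clamp (M : ℝ) : Continuous (clamp M) :=
  continuous_const.max (continuous_id.min continuous_const)

lemma abs_clamp_le {M : ℝ} (hM : 0 ≤ M) (t : ℝ) : |clamp M t| ≤ M :=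
  abs_le.2 ⟨le_max_left _ _, max_le (by linarith) (min_le_right _ _)⟩

/-- The truncation lies between `0` and `t`, so correlating it with the score gives at least its own
second moment. -/
lemma clamp_sq_le {M : ℝ} (hM : 0 ≤ M) (t : ℝ) : clamp M t ^ 2 ≤ clamp M t * t := by
  rw [clamp]
  rcases le_total t M with h1 | h1 <;> rcases le_total (-M) t with h2 | h2
  · rw [min_eq_left h1, max_eq_right h2]; exact (sq t).le
  · rw [min_eq_left h1, max_eq_left h2]; nlinarith
  · rw [min_eq_right h1, max_eq_right (by linarith)]; nlinarith
  · rw [min_eq_right h1, max_eq_right (by linarith)]; nlinarith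

lemma clamp_sq_le_sq {M : ℝ} (hM : 0 ≤ M) (t : ℝ) : clamp M t ^ 2 ≤ t ^ 2 := by
  have h := clamp_sq_le hM t
  nlinarith [sq_nonneg (clamp M t - t)]

lemma tendsto_integral_clamp_sq {J : ℝ} (hJ : 0 ≤ J) :
    Tendsto (fun M : ℕ => ∫ t, clamp M t ^ 2 ∂(gaussianReal 0 J.toNNReal)) atTop (𝓝 J) := by
  have hv := variance_of_integral_eq_zero (X := fun t : ℝ => t) (μ := gaussianReal 0 J.toNNReal)
    aemeasurable_id integral_id_gaussianReal
  rw [variance_fun_id_gaussianReal, Real.coe_toNNReal _ hJ] at hv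
  conv => rhs; rw [hv]
  refine tendsto_integral_of_dominated_convergence (fun t => t ^ 2)
    (fun M => ((continuous_clamp M).pow 2).aestronglyMeasurable)
    (memLp_id_gaussianReal 2).integrable_sq (fun M => ae_of_all _ fun t => ?_)
    (ae_of_all _ fun t => ?_)
  · rw [Real.norm_of_nonneg (sq_nonneg _)]
    exact clamp_sq_le_sq (Nat.cast_nonneg M) t
  · refine tendsto_const_nhds.congr' ?_
    obtain ⟨N, hN⟩ := exists_nat_ge |t|
    filter_upwards [eventually_ge_atTop N] with M hM
    have hM' : |t| ≤ M := hN.trans (by exact_mod_cast hM)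
    rw [clamp, min_eq_left (abs_le.1 hM').2, max_eq_right (abs_le.1 hM').1]

/-- The lower bound for the Fisher information at an approximation of a product distribution. -/
lemma fisher_ge_of_approx {p₀ δ₀ p δ T : B → ℝ} {r d M β : ℝ} (hM : 0 ≤ M) (hβ : 0 < β)
    (hp₀ : IsDensity p₀) (hδ₀ : IsLocalTangent p₀ δ₀) (hp : IsDensity p) (hδ : IsLocalTangent p δ)
    (hT : Measurable T) (hT2 : MemLp T 2 (law p₀)) (he : ∀ᵐ y, δ₀ y = β * (p₀ y * T y))
    (hr : ∫ y, ‖p y - p₀ y‖ ≤ r) (hd : ∫ y, ‖δ y - δ₀ y‖ ≤ β * d)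
    (hpos : 0 ≤ ∫ y, clamp M (T y) ^ 2 ∂(law p₀) - M * d) :
    (∫ y, clamp M (T y) ^ 2 ∂(law p₀) - M * d) ^ 2
      ≤ (1 / β ^ 2 * (fisher p δ).toReal) * (∫ y, clamp M (T y) ^ 2 ∂(law p₀) + M ^ 2 * r) := by
  have := hp₀.isProbabilityMeasure_law
  have := hp.isProbabilityMeasure_law
  -- The test function in the Cauchy–Schwarz inequality at `{p, δ}`. Passing to `{p₀, δ₀}` costs at
  -- most `M` times the `L¹` distance of the tangent vectors (`h2`) and `M ^ 2` times that of the
  -- densities (`h3`).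
  let f : B → ℝ := fun y => clamp M (T y)
  have hfm : Measurable f := (continuous_clamp M).measurable.comp hT
  have hfb : ∀ y, |f y| ≤ M := fun y => abs_clamp_le hM _
  have hf2b : ∀ y, |f y ^ 2| ≤ M ^ 2 := fun y => by
    rw [abs_pow]
    exact pow_le_pow_left₀ (abs_nonneg _) (hfb y) 2
  set e : ℝ := ∫ y, f y ^ 2 ∂(law p₀) with hedef
  have hfL : MemLp f 2 (law p) :=
    MemLp.of_bound hfm.aestronglyMeasurable M (ae_of_all _ fun y => hfb y)
  have hf2 : Integrable (fun y => f y ^ 2) (law p₀) :=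
    Integrable.of_bound (hfm.pow_const 2).aestronglyMeasurable (M ^ 2) (ae_of_all _ hf2b)
  have hf2' : Integrable (fun y => f y ^ 2) (law p) :=
    Integrable.of_bound (hfm.pow_const 2).aestronglyMeasurable (M ^ 2) (ae_of_all _ hf2b)
  have hfT : Integrable (fun y => f y * T y) (law p₀) :=
    (hT2.integrable one_le_two).bdd_mul hfm.aestronglyMeasurable (ae_of_all _ hfb)
  have hfδ : Integrable fun y => f y * δ y :=
    hδ.integrable.bdd_mul hfm.aestronglyMeasurable (ae_of_all _ hfb)
  have hfδ₀ : Integrable fun y => f y * δ₀ y :=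
    hδ₀.integrable.bdd_mul hfm.aestronglyMeasurable (ae_of_all _ hfb)
  have h1 : β * e ≤ ∫ y, f y * δ₀ y := by
    have e1 : ∫ y, f y * δ₀ y = β * ∫ y, f y * T y ∂(law p₀) := by
      rw [hp₀.integral_law, ← integral_const_mul]
      refine integral_congr_ae (he.mono fun y hy => ?_)
      simp only [hy]
      ring
    rw [e1]
    exact mul_le_mul_of_nonneg_left (integral_mono hf2 hfT fun y => clamp_sq_le hM (T y)) hβ.le
  have h2 : (∫ y, f y * δ₀ y) - ∫ y, f y * δ y ≤ M * (β * d) := by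
    rw [← integral_sub hfδ₀ hfδ]
    refine le_trans (integral_mono (hfδ₀.sub hfδ)
      ((hδ.integrable.sub hδ₀.integrable).norm.const_mul M) fun y => ?_) ?_
    · simp only [Pi.sub_apply]
      rw [← mul_sub, norm_sub_rev]
      refine (le_abs_self _).trans ?_
      rw [abs_mul]
      exact mul_le_mul_of_nonneg_right (hfb y) (abs_nonneg _)
    · rw [integral_const_mul]
      exact mul_le_mul_of_nonneg_left hd hM
  have h3 : ∫ y, p y * f y ^ 2 ≤ e + M ^ 2 * r := by
    have i1 := (hp.integrable_law_iff _).1 hf2'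
    have i2 := (hp₀.integrable_law_iff _).1 hf2
    have : (∫ y, p y * f y ^ 2) - ∫ y, p₀ y * f y ^ 2 ≤ M ^ 2 * r := by
      rw [← integral_sub i1 i2]
      refine le_trans (integral_mono (i1.sub i2)
        ((hp.integrable.sub hp₀.integrable).norm.const_mul (M ^ 2)) fun y => ?_) ?_
      · simp only [Pi.sub_apply]
        rw [← sub_mul, mul_comm]
        refine (le_abs_self _).trans ?_
        rw [abs_mul]
        exact mul_le_mul_of_nonneg_right (hf2b y) (abs_nonneg _)
      · rw [integral_const_mul]
        exact mul_le_mul_of_nonneg_left hr (sq_nonneg M)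
    rw [← hp₀.integral_law] at this
    linarith
  have h4 := hδ.sq_integral_mul_le hp hfL
  have h5 : β * (e - M * d) ≤ ∫ y, f y * δ y := by linarith
  have h6 : (β * (e - M * d)) ^ 2 ≤ (fisher p δ).toReal * (e + M ^ 2 * r) :=
    (pow_le_pow_left₀ (mul_nonneg hβ.le hpos) h5 2).trans
      (h4.trans (mul_le_mul_of_nonneg_left h3 ENNReal.toReal_nonneg))
  have hβ2 : 0 < β ^ 2 := by positivity
  rw [mul_pow, ← le_div_iff₀' hβ2] at h6
  refine h6.trans_eq ?_
  ring

/-- The minimal metric is weakly asymptotically continuous. -/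
lemma axiomC_Gmin : AxiomC Gmin := by
  intro A B _ Φ Δ hΦ hΔ Φs Δs hΦs hΔs hlimΦ hlimΔ
  obtain ⟨x₀, -, hmax⟩ := exists_fisher_eq_Gmin hΔ
  set J : ℝ := (fisher (Φ x₀) (Δ x₀)).toReal with hJdef
  have hJ0 : 0 ≤ J := ENNReal.toReal_nonneg
  let x : ∀ n, A.power n := fun n (_ : Fin n) => x₀
  -- Enough because `Gmin / n` at the tensor power is at most `J`, while at the approximation it
  -- dominates the Fisher information at any input, here the constant sequence at `x₀`.
  suffices key : ∀ θ > 0, ∀ᶠ n : ℕ in atTop,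
      J - θ ≤ 1 / (n : ℝ) * (fisher (Φs n (x n)) (Δs n (x n))).toReal by
    refine le_of_forall_lt fun c hc => ?_
    obtain ⟨c', hc1, hc2⟩ := EReal.lt_iff_exists_real_btwn.1 hc
    refine hc1.trans_le (le_liminf_of_le (by isBoundedDefault) ?_)
    have hc0 : c' < 0 := by exact_mod_cast hc2
    filter_upwards [key (-c') (neg_pos.2 hc0), eventually_gt_atTop 0] with n hn hn0
    have h1 := Gmin_tangentPow_le hΦ hΔ hmax hn0
    have h2 := mul_le_mul_of_nonneg_left (fisher_le_Gmin (hΔs n) (x n))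
      (by positivity : 0 ≤ 1 / (n : ℝ))
    refine EReal.coe_le_coe_iff.2 ?_
    rw [mul_sub]
    linarith
  intro θ hθ
  rcases hJ0.eq_or_lt' with hJz | hJpos
  · refine Eventually.of_forall fun n => ?_
    have : 0 ≤ 1 / (n : ℝ) * (fisher (Φs n (x n)) (Δs n (x n))).toReal :=
      mul_nonneg (by positivity) ENNReal.toReal_nonneg
    linarith
  have hm1 : ∀ n y, Measurable ((Φs n - tensorPow Φ n) y) := fun n y =>
    (hΦs n y).measurable.sub (hΦ.tensorPow n y).measurable
  have hm2 : ∀ n y, Measurable ((Δs n - tangentPow Φ Δ n) y) := fun n y =>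
    ((hΔs n).isLocalTangent y).measurable.sub (measurable_tangentPow hΦ hΔ y)
  let r : ℕ → ℝ := fun n => ∫ y, ‖Φs n (x n) y - tensorPow Φ n (x n) y‖
  let d : ℕ → ℝ := fun n => (∫ y, ‖Δs n (x n) y - tangentPow Φ Δ n (x n) y‖) / √n
  have hr : Tendsto r atTop (𝓝 0) := by
    have h : Tendsto (fun n => ∫⁻ y, ‖(Φs n - tensorPow Φ n) (x n) y‖ₑ) atTop (𝓝 0) :=
      tendsto_of_tendsto_of_tendsto_of_le_of_le tendsto_const_nhds hlimΦ (fun _ => zero_le)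
        fun n => le_cbNorm (hm1 n) (x n)
    refine ((ENNReal.tendsto_toReal ENNReal.zero_ne_top).comp h).congr fun n => ?_
    exact (integral_norm_eq_lintegral_enorm (hm1 n (x n)).aestronglyMeasurable).symm
  have hd : Tendsto d atTop (𝓝 0) := by
    have h : Tendsto (fun n : ℕ => (∫⁻ y, ‖(Δs n - tangentPow Φ Δ n) (x n) y‖ₑ)
        / ENNReal.ofReal √(n : ℝ)) atTop (𝓝 0) :=
      tendsto_of_tendsto_of_tendsto_of_le_of_le tendsto_const_nhds hlimΔ (fun _ => zero_le)
        fun n => ENNReal.div_le_div_right (le_cbNorm (hm2 n) (x n)) _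
    refine ((ENNReal.tendsto_toReal ENNReal.zero_ne_top).comp h).congr fun n => ?_
    simp only [Function.comp, d]
    rw [ENNReal.toReal_div, ENNReal.toReal_ofReal (Real.sqrt_nonneg _)]
    congr 1
    exact (integral_norm_eq_lintegral_enorm (hm2 n (x n)).aestronglyMeasurable).symm
  -- The truncated variance `v` increases to `J` in the limit; `M` is chosen so that `v` exceeds `J
  -- - θ / 2` and is positive, as needed for division.
  obtain ⟨M, hM⟩ := ((tendsto_integral_clamp_sq hJ0).eventually
    (eventually_gt_nhds (max_lt (sub_lt_self J (half_pos hθ)) hJpos))).exists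
  set v : ℝ := ∫ t, clamp M t ^ 2 ∂(gaussianReal 0 J.toNNReal) with hv
  have hv0 : 0 < v := (le_max_right _ _).trans_lt hM
  have hvθ : J - θ < v := by
    have := (le_max_left _ _).trans_lt hM
    linarith
  let e : ℕ → ℝ := fun n =>
    ∫ y, clamp M (normScore Φ Δ n (x n) y) ^ 2 ∂(law (tensorPow Φ n (x n)))
  have hM0 : (0 : ℝ) ≤ M := Nat.cast_nonneg M
  have hT := fun n => measurable_normScore hΦ hΔ (x n)
  have he : Tendsto e atTop (𝓝 v) := by
    have hprob := fun n => isProbabilityMeasure_smearedLaw (σ := 0) (hΦ.tensorPow n (x n)) (hT n)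
    let μ : ℕ → ProbabilityMeasure ℝ := fun n => ⟨_, hprob n⟩
    let γ : ProbabilityMeasure ℝ := ⟨gaussianReal 0 J.toNNReal, inferInstance⟩
    have hlim : Tendsto μ atTop (𝓝 γ) := by
      -- At the constant sequence of maximizers the variance is already `J`, so no noise is added.
      refine tendsto_smearedLaw_scoreSum hΦ hΔ hmax x (fun _ => 0) (fun n hn => ?_) μ
        (fun n => rfl) γ rfl
      have hn' : (n : ℝ) ≠ 0 := by exact_mod_cast hn.ne'
      have e1 : fisherSum Φ Δ n (x n) = ∑ _i : Fin n, J := rfl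
      rw [e1, Finset.sum_const, Finset.card_univ, Fintype.card_fin, nsmul_eq_mul,
        mul_div_cancel_left₀ _ hn']
      ring
    have hcont : Continuous fun t => clamp M t ^ 2 := (continuous_clamp M).pow 2
    have h := ProbabilityMeasure.tendsto_iff_forall_integral_tendsto.1 hlim
      (BoundedContinuousFunction.ofNormedAddCommGroup (fun t => clamp M t ^ 2) hcont ((M : ℝ) ^ 2)
        fun t => by
          rw [norm_pow]
          exact pow_le_pow_left₀ (norm_nonneg _) (abs_clamp_le hM0 t) 2)
    refine h.congr fun n => ?_
    have := (hΦ.tensorPow n (x n)).isProbabilityMeasure_law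
    refine (integral_comp_smearedLaw (f := fun t => clamp M t ^ 2) (hT n) hcont.measurable).trans ?_
    simp only [zero_mul, add_zero]
    rw [integral_fun_fst (μ := law (tensorPow Φ n (x n))) (ν := gaussianReal 0 1)
      fun y => clamp M (normScore Φ Δ n (x n) y) ^ 2]
    simp [e]
  have hnum : Tendsto (fun n => e n - M * d n) atTop (𝓝 v) := by
    simpa using he.sub (hd.const_mul (M : ℝ))
  have hden : Tendsto (fun n => e n + (M : ℝ) ^ 2 * r n) atTop (𝓝 v) := by
    simpa using he.add (hr.const_mul ((M : ℝ) ^ 2))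
  -- The lower bound of the Cauchy–Schwarz inequality; its limit is `v ^ 2 / v = v > J - θ`.
  have hratio : Tendsto (fun n => (e n - M * d n) ^ 2 / (e n + (M : ℝ) ^ 2 * r n)) atTop (𝓝 v) := by
    have hv2 : v ^ 2 / v = v := by rw [sq, mul_div_cancel_right₀ _ hv0.ne']
    exact hv2 ▸ (hnum.pow 2).div hden hv0.ne'
  filter_upwards [hratio.eventually (eventually_gt_nhds hvθ),
    hnum.eventually (eventually_gt_nhds hv0), hden.eventually (eventually_gt_nhds hv0),
    eventually_gt_atTop 0] with n h1 h2 h3 hn0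
  have hsn : 0 < √(n : ℝ) := Real.sqrt_pos.2 (by exact_mod_cast hn0)
  have h := fisher_ge_of_approx hM0 hsn (hΦ.tensorPow n (x n))
    (isLocalTangent_tangentPow hΦ hΔ (x n)) (hΦs n (x n)) ((hΔs n).isLocalTangent (x n)) (hT n)
    (memLp_normScore hΦ hΔ (x n)) (tangentPow_ae_eq_normScore hΦ hΔ hn0 (x n)) le_rfl
    (d := d n) (by simp only [d]; rw [mul_div_cancel₀ _ hsn.ne']) h2.le
  rw [Real.sq_sqrt (Nat.cast_nonneg n)] at h
  exact h1.le.trans ((div_le_iff₀ h3).2 h)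

end Gmin

/-- A metric that satisfies the axioms is the minimal metric. -/
lemma metric_eq_Gmin {G : ChannelFunctional} (hG : IsChannelMetric G) (hM1 : AxiomM1 G)
    (hM2 : AxiomM2 G) (hE : AxiomE G) (hA : AxiomA G) (hC : AxiomC G) (hN : AxiomN0 G)
    {A B : Space} [Finite A] {Φ Δ : A → B → ℝ} (hΦ : IsChannel Φ) (hΔ : IsTangent Φ Δ) :
    G A B Φ Δ = Gmin A B Φ Δ := by
  obtain ⟨x₀, e, hmax⟩ := exists_fisher_eq_Gmin hΔ
  rw [e]
  refine le_antisymm ?_ (fisher_le_channelMetric hG hM1 hM2 hA hC hN hΦ hΔ x₀)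
  -- The simulation needs a nondegenerate Gaussian; for `J = 0` the tangent vector vanishes almost
  -- everywhere and definiteness of the norm applies.
  rcases (ENNReal.toReal_nonneg : 0 ≤ (fisher (Φ x₀) (Δ x₀)).toReal).eq_or_lt' with h0 | h0
  · rw [h0]
    refine ((hG.eq_zero_iff A B Φ Δ hΦ hΔ).2 fun x => ?_).le
    refine ae_eq_zero_of_fisher_eq_zero (hΦ x) (hΔ.isLocalTangent x) ?_
    have := le_antisymm (h0 ▸ hmax x) ENNReal.toReal_nonneg
    exact (ENNReal.toReal_eq_zero_iff _).1 this |>.resolve_right (hΔ.2 x).ne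
  · exact metric_le_of_fisher_le hG hM1 hM2 hE hA hC hN hΦ hΔ h0 hmax

end

theorem mainTheorem2 :
    (∀ (A B : Space) [Finite A] (Φ Δ : A → B → ℝ), IsChannel Φ → IsTangent Φ Δ →
      (∀ x, IsRegularLocalData (Φ x) (Δ x)) →
      ∀ G : ChannelFunctional, IsChannelMetric G →
        AxiomM1 G → AxiomM2 G → AxiomE G → AxiomA G → AxiomC G → AxiomN0 G →
        G A B Φ Δ = Gmin A B Φ Δ) ∧
    AxiomC Gmin :=
  ⟨fun _ _ _ _ _ hΦ hΔ _ _ hG hM1 hM2 hE hA hC hN =>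
    metric_eq_Gmin hG hM1 hM2 hE hA hC hN hΦ hΔ, axiomC_Gmin⟩
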